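/- Let $d,m,n,\widetilde n\ge 1$ be integers, let $b>0$, $\sigma_\epsilon>0$, $c>0$ and $\sigma_\eta,\sigma_\xi\in\mathbb R$, and let $H_1,\dots,H_m\in\mathbb R^{d\times d}$ satisfy $H_j^TH_j=I_d$. *Data.* The target parameter is $\beta\sim\mathcal N(0,\tfrac bd I_d)$. The target training set consists of $n$ i.i.d. pairs $(x^{(i)},y^{(i)})$ with $y^{(i)}=x^{(i),T}\beta+\epsilon^{(i)}$, where $x^{(i)}\in\mathbb R^d$ has zero mean and isotropic covariance $cI_d$ (e.g. $c=1$), and $\epsilon^{(i)}$ has zero mean and variance $\sigma_\epsilon^2$ and is independent of $x^{(i)}$. Let $X\in\mathbb R^{n\times d}$ and $y\in\mathbb R^n$ collect these data, and let $(x^{\rm test},y^{\rm test})$ be a further independent pair from the same model. For $j=1,\dots,m$ the $j$-th source task has parameter $\theta_j=H_j\beta+\eta_j$ with $\eta_j\sim\mathcal N(0,\tfrac{\sigma_\eta^2}{d}I_d)$ and data $v_j=Z_j\theta_j+\xi_j$, where $Z_j\in\mathbb R^{\widetilde n\times d}$ has i.i.d. $\mathcal N(0,I_d)$ rows and $\xi_j\in\mathbb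 R^{\widetilde n}$ has i.i.d. zero-mean entries of variance $\sigma_\xi^2$. All of $\beta$, the $\eta_j$, $Z_j$, $\xi_j$, and the target training and test inputs and noises are independent. *Estimators.* The pretrained models are $\widehat\theta_j=Z_j^+v_j$, with $Z_j^+$ the Moore–Penrose pseudoinverse. For $\alpha>0$ put $$\widehat\beta_{\rm TL}(\alpha)=\Big(X^TX+n\alpha\sum_{j=1}^mH_j^TH_j\Big)^{-1}\Big(X^Ty+n\alpha\sum_{j=1}^mH_j^T\widehat\theta_j\Big),\qquad \widehat\beta_{\rm ridge}(\alpha)=\big(X^TX+n\alpha I_d\big)^{-1}X^Ty,$$ which are the minimizers over $r\in\mathbb R^d$ of $\|y-Xr\|_2^2+n\alpha\sum_j\|H_jr-\widehat\theta_j\|_2^2$ and of $\|y-Xr\|_2^2+n\alpha\|r\|_2^2$, respectively. Let $\bar{\mathcal E}_{\rm TL}(\alpha)$ and $\bar{\mathcal E}_{\rm ridge}(\alpha)$ be the expected test errors $\mathbb E\big[(x^{{\rm test},T}\widehat\beta-y^{\rm test})^2\big]\in[0,\infty]$ of these estimators, the expectation being over all random elements including $\beta$. *Claim.* Let $\rho=1$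 if $\widetilde n\ge d$ and $\rho=\widetilde n/d$ if $\widetilde n<d$. If $d\notin\{\widetilde n-1,\widetilde n,\widetilde n+1\}$ and $$\sigma_\eta^2+\frac{d\,\sigma_\xi^2}{|d-\widetilde n|-1}<b\big(m+(m-1)(1-\rho)\big),$$ then optimally tuned transfer learning is strictly better than optimally tuned ridge regression: $$\inf_{\alpha>0}\bar{\mathcal E}_{\rm TL}(\alpha)<\inf_{\alpha>0}\bar{\mathcal E}_{\rm ridge}(\alpha).$$ -/

import Mathlib

open MeasureTheory ProbabilityTheory
open scoped ENNReal Matrix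

/-! Moore-Penrose pseudoinverse of a real matrix. -/

/-- `P` satisfies the four Penrose equations for `A`. -/
structure IsMoorePenrose {p q : ℕ} (A : Matrix (Fin p) (Fin q) ℝ)
    (P : Matrix (Fin q) (Fin p) ℝ) : Prop where
  mul_mul_self : A * P * A = A
  self_mul_mul : P * A * P = P
  symm_left : (A * P)ᵀ = A * P
  symm_right : (P * A)ᵀ = P * A

theorem IsMoorePenrose.unique {p q : ℕ} {A : Matrix (Fin p) (Fin q) ℝ}
    {P Q : Matrix (Fin q) (Fin p) ℝ} (hP : IsMoorePenrose A P) (hQ : IsMoorePenrose A Q) :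
    P = Q := by
  have e1 : A * P = A * Q := by
    calc A * P = (A * Q * A) * P := by rw [hQ.mul_mul_self]
      _ = (A * Q)ᵀ * (A * P)ᵀ := by rw [hQ.symm_left, hP.symm_left]; simp only [Matrix.mul_assoc]
      _ = (A * P * A * Q)ᵀ := by rw [← Matrix.transpose_mul]; simp only [Matrix.mul_assoc]
      _ = A * Q := by rw [hP.mul_mul_self, hQ.symm_left]
  have e2 : P * A = Q * A := by
    calc P * A = P * (A * Q * A) := by rw [hQ.mul_mul_self]
      _ = (P * A)ᵀ * (Q * A)ᵀ := by rw [hQ.symm_right, hP.symm_right]; simp only [Matrix.mul_assoc]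
      _ = (Q * (A * P * A))ᵀ := by rw [← Matrix.transpose_mul]; simp only [Matrix.mul_assoc]
      _ = Q * A := by rw [hP.mul_mul_self, hQ.symm_right]
  calc P = P * A * P := hP.self_mul_mul.symm
    _ = Q * (A * P) := by rw [e2, Matrix.mul_assoc]
    _ = Q * A * Q := by rw [e1, Matrix.mul_assoc]
    _ = Q := hQ.self_mul_mul

theorem exists_isMoorePenrose {p q : ℕ} (A : Matrix (Fin p) (Fin q) ℝ) :
    ∃ P : Matrix (Fin q) (Fin p) ℝ, IsMoorePenrose A P := by
  have hS : (Aᵀ * A).IsHermitian := by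
    simpa using Matrix.isHermitian_conjTranspose_mul_self A
  obtain ⟨U, D, hU, hSU⟩ : ∃ (U : Matrix (Fin q) (Fin q) ℝ) (D : Fin q → ℝ),
      Uᵀ * U = 1 ∧ Aᵀ * A = U * Matrix.diagonal D * Uᵀ := by
    refine ⟨hS.eigenvectorUnitary, hS.eigenvalues, ?_, ?_⟩
    · exact (Matrix.mem_unitaryGroup_iff'.mp hS.eigenvectorUnitary.2)
    · exact hS.spectral_theorem
  have hDD : Matrix.diagonal D * Matrix.diagonal (fun i => (D i)⁻¹) * Matrix.diagonal D
      = Matrix.diagonal D := by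
    simp [Matrix.diagonal_mul_diagonal]
  have hDD' : Matrix.diagonal (fun i => (D i)⁻¹) * Matrix.diagonal D *
      Matrix.diagonal (fun i => (D i)⁻¹) = Matrix.diagonal (fun i => (D i)⁻¹) := by
    simp only [Matrix.diagonal_mul_diagonal]
    congr 1
    funext i
    by_cases h : D i = 0 <;> simp [h]
  have hcomm : Matrix.diagonal D * Matrix.diagonal (fun i => (D i)⁻¹)
      = Matrix.diagonal (fun i => (D i)⁻¹) * Matrix.diagonal D := by
    simp [Matrix.diagonal_mul_diagonal, mul_comm]
  set E := Matrix.diagonal D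
  set F := Matrix.diagonal (fun i => (D i)⁻¹) with hF
  have hcan : ∀ M N : Matrix (Fin q) (Fin q) ℝ, (U * M * Uᵀ) * (U * N * Uᵀ) = U * (M * N) * Uᵀ := by
    intro M N
    calc (U * M * Uᵀ) * (U * N * Uᵀ) = U * M * (Uᵀ * U) * N * Uᵀ := by
          simp only [Matrix.mul_assoc]
      _ = U * (M * N) * Uᵀ := by rw [hU]; simp only [Matrix.mul_assoc, Matrix.mul_one]
  obtain ⟨T, hT⟩ : ∃ T, T = U * F * Uᵀ := ⟨_, rfl⟩
  have hTt : Tᵀ = T := by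
    rw [hT, hF]
    simp [Matrix.transpose_mul, Matrix.mul_assoc]
  have h1 : (Aᵀ * A) * T * (Aᵀ * A) = Aᵀ * A := by rw [hSU, hT, hcan, hcan, hDD]
  have h2 : T * (Aᵀ * A) * T = T := by rw [hSU, hT, hcan, hcan, hDD']
  have h3 : (Aᵀ * A) * T = T * (Aᵀ * A) := by rw [hSU, hT, hcan, hcan, hcomm]
  have h4 : A * (T * (Aᵀ * A)) = A := by
    have : (A * (T * (Aᵀ * A)) - A)ᵀ * (A * (T * (Aᵀ * A)) - A) = 0 := by
      have e : (A * (T * (Aᵀ * A)) - A)ᵀ = (Aᵀ * A) * T * Aᵀ - Aᵀ := by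
        simp [Matrix.transpose_mul, hTt, Matrix.mul_assoc]
      rw [e]
      calc _ = (Aᵀ * A) * T * (Aᵀ * A) * (T * (Aᵀ * A)) - (Aᵀ * A) * T * (Aᵀ * A)
            - ((Aᵀ * A) * T * (Aᵀ * A) - Aᵀ * A) := by
            simp only [Matrix.sub_mul, Matrix.mul_sub, Matrix.mul_assoc]
        _ = 0 := by rw [h1, ← Matrix.mul_assoc (Aᵀ * A) T, h1]; simp
    have h := Matrix.conjTranspose_mul_self_eq_zero.mp
      (show (A * (T * (Aᵀ * A)) - A)ᴴ * (A * (T * (Aᵀ * A)) - A) = 0 by simpa using this)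
    exact sub_eq_zero.mp h
  refine ⟨T * Aᵀ, ?_, ?_, ?_, ?_⟩
  · simpa only [Matrix.mul_assoc] using h4
  · calc T * Aᵀ * A * (T * Aᵀ) = (T * (Aᵀ * A) * T) * Aᵀ := by simp only [Matrix.mul_assoc]
      _ = T * Aᵀ := by rw [h2]
  · simp [Matrix.transpose_mul, hTt, Matrix.mul_assoc]
  · calc (T * Aᵀ * A)ᵀ = (Aᵀ * A) * T := by simp [Matrix.transpose_mul, hTt, Matrix.mul_assoc]
      _ = T * Aᵀ * A := by rw [h3, Matrix.mul_assoc]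

/-- The Moore-Penrose pseudoinverse. -/
noncomputable def pinv {p q : ℕ} (A : Matrix (Fin p) (Fin q) ℝ) : Matrix (Fin q) (Fin p) ℝ :=
  (exists_isMoorePenrose A).choose

theorem pinv_spec {p q : ℕ} (A : Matrix (Fin p) (Fin q) ℝ) : IsMoorePenrose A (pinv A) :=
  (exists_isMoorePenrose A).choose_spec

/-! Laws of the inputs, parameters and noises. -/

/-- The Gaussian law `N(0, s I_d)` on `ℝ^d`: independent coordinates `N(0, s)`. -/
noncomputable def isoGaussian (d : ℕ) (s : ℝ) : Measure (Fin d → ℝ) :=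
  Measure.pi fun _ => gaussianReal 0 s.toNNReal

/-- A real law with zero mean and variance `σ ^ 2`. -/
structure IsNoiseLaw (μ : Measure ℝ) (σ : ℝ) : Prop where
  isProbabilityMeasure : IsProbabilityMeasure μ
  memLp : MemLp id 2 μ
  mean_zero : ∫ t, t ∂μ = 0
  variance_eq : ∫ t, t ^ 2 ∂μ = σ ^ 2

/-- A law on `ℝ^d` with zero mean and covariance matrix `c I_d`. -/
structure IsIsotropicInputLaw {d : ℕ} (μ : Measure (Fin d → ℝ)) (c : ℝ) : Prop where
  isProbabilityMeasure : IsProbabilityMeasure μ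
  memLp : ∀ k, MemLp (fun x : Fin d → ℝ => x k) 2 μ
  mean_zero : ∀ k, ∫ x, x k ∂μ = 0
  covariance_eq : ∀ k l, ∫ x, x k * x l ∂μ = (c • (1 : Matrix (Fin d) (Fin d) ℝ)) k l

/-! The random data. -/

/-- Randomness of one source task with `k` examples: the task relation noise `η`,
the `k` inputs `z⁽ⁱ⁾` (rows of `Z`), and the `k` output noises `ξ⁽ⁱ⁾`. -/
abbrev SourceSample (d k : ℕ) : Type := (Fin d → ℝ) × (Fin k → Fin d → ℝ) × (Fin k → ℝ)

/-- Randomness of the target training set with `n` examples: the inputs `x⁽ⁱ⁾` (rows of `X`)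
and the output noises `ε⁽ⁱ⁾`. -/
abbrev TargetSample (d n : ℕ) : Type := (Fin n → Fin d → ℝ) × (Fin n → ℝ)

/-- All random elements: target parameter `β`, the `m` sources, the target training set,
and the test pair (test input and test noise). -/
abbrev Sample (d m n k : ℕ) : Type :=
  (Fin d → ℝ) × (Fin m → SourceSample d k) × TargetSample d n × ((Fin d → ℝ) × ℝ)

/-- Law of one source sample: `η ∼ N(0, (ση² / d) I_d)`, i.i.d. inputs `z⁽ⁱ⁾ ∼ N(0, I_d)`,
i.i.d. noises with law `μξ`, all independent. -/
noncomputable def sourceLaw (d k : ℕ) (ση : ℝ) (μξ : Measure ℝ) : Measure (SourceSample d k) :=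
  (isoGaussian d (ση ^ 2 / d)).prod
    ((Measure.pi fun _ : Fin k => isoGaussian d 1).prod (Measure.pi fun _ : Fin k => μξ))

/-- Joint law: `β ∼ N(0, (b / d) I_d)`, the `m` sources, the `n` target training examples
and the test example are independent. -/
noncomputable def jointLaw (d m n k : ℕ) (b ση : ℝ) (μξ : Fin m → Measure ℝ)
    (μx : Measure (Fin d → ℝ)) (με : Measure ℝ) : Measure (Sample d m n k) :=
  (isoGaussian d (b / d)).prod
    ((Measure.pi fun j => sourceLaw d k ση (μξ j)).prod
      (((Measure.pi fun _ : Fin n => μx).prod (Measure.pi fun _ : Fin n => με)).prod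
        (μx.prod με)))

/-! Estimators. -/

/-- The pretrained source model `θ̂ = Z⁺ v`, where `v = Z θ + ξ` and `θ = H β + η`. -/
noncomputable def sourceEstimate {d k : ℕ} (H : Matrix (Fin d) (Fin d) ℝ) (β : Fin d → ℝ)
    (s : SourceSample d k) : Fin d → ℝ :=
  pinv (Matrix.of s.2.1) *ᵥ (Matrix.of s.2.1 *ᵥ (H *ᵥ β + s.1) + s.2.2)

/-- `‖y - X r‖² + n α ∑ⱼ ‖Hⱼ r - θⱼ‖²` (Euclidean norms). -/
def transferObjective {d m n : ℕ} (α : ℝ) (H : Fin m → Matrix (Fin d) (Fin d) ℝ)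
    (X : Matrix (Fin n) (Fin d) ℝ) (y : Fin n → ℝ) (θ : Fin m → Fin d → ℝ) (r : Fin d → ℝ) : ℝ :=
  (y - X *ᵥ r) ⬝ᵥ (y - X *ᵥ r) + n * α * ∑ j, (H j *ᵥ r - θ j) ⬝ᵥ (H j *ᵥ r - θ j)

/-- The transfer learning estimator with hyperparameter `α`:
`(Xᵀ X + n α ∑ⱼ Hⱼᵀ Hⱼ)⁻¹ (Xᵀ y + n α ∑ⱼ Hⱼᵀ θⱼ)`. -/
noncomputable def transferEstimator {d m n : ℕ} (α : ℝ) (H : Fin m → Matrix (Fin d) (Fin d) ℝ)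
    (X : Matrix (Fin n) (Fin d) ℝ) (y : Fin n → ℝ) (θ : Fin m → Fin d → ℝ) : Fin d → ℝ :=
  (Xᵀ * X + (n * α) • ∑ j, (H j)ᵀ * H j)⁻¹ *ᵥ (Xᵀ *ᵥ y + (n * α) • ∑ j, (H j)ᵀ *ᵥ θ j)

/-- The ridge regression estimator with hyperparameter `α`: `(Xᵀ X + n α I)⁻¹ Xᵀ y`. -/
noncomputable def ridgeEstimator {d n : ℕ} (α : ℝ) (X : Matrix (Fin n) (Fin d) ℝ)
    (y : Fin n → ℝ) : Fin d → ℝ :=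
  (Xᵀ * X + (n * α) • (1 : Matrix (Fin d) (Fin d) ℝ))⁻¹ *ᵥ (Xᵀ *ᵥ y)

theorem transferObjective_add {d m n : ℕ} (α : ℝ) (H : Fin m → Matrix (Fin d) (Fin d) ℝ)
    (X : Matrix (Fin n) (Fin d) ℝ) (y : Fin n → ℝ) (θ : Fin m → Fin d → ℝ) (r u : Fin d → ℝ) :
    transferObjective α H X y θ (r + u) = transferObjective α H X y θ r
      + 2 * (u ⬝ᵥ ((Xᵀ * X + (n * α) • ∑ j, (H j)ᵀ * H j) *ᵥ r
          - (Xᵀ *ᵥ y + (n * α) • ∑ j, (H j)ᵀ *ᵥ θ j)))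
      + ((X *ᵥ u) ⬝ᵥ (X *ᵥ u) + n * α * ∑ j, (H j *ᵥ u) ⬝ᵥ (H j *ᵥ u)) := by
  have key : ∀ {p : ℕ} (A : Matrix (Fin p) (Fin d) ℝ) (v : Fin p → ℝ),
      u ⬝ᵥ (Aᵀ *ᵥ v) = (A *ᵥ u) ⬝ᵥ v := by
    intro p A v
    rw [Matrix.dotProduct_mulVec, Matrix.vecMul_transpose]
  have e1 : (y - X *ᵥ (r + u)) ⬝ᵥ (y - X *ᵥ (r + u)) = (y - X *ᵥ r) ⬝ᵥ (y - X *ᵥ r)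
      + 2 * ((X *ᵥ u) ⬝ᵥ (X *ᵥ r) - (X *ᵥ u) ⬝ᵥ y) + (X *ᵥ u) ⬝ᵥ (X *ᵥ u) := by
    simp only [Matrix.mulVec_add, sub_dotProduct, dotProduct_sub, add_dotProduct, dotProduct_add]
    rw [dotProduct_comm y (X *ᵥ u), dotProduct_comm (X *ᵥ r) (X *ᵥ u)]
    ring
  have e2 : ∀ j, (H j *ᵥ (r + u) - θ j) ⬝ᵥ (H j *ᵥ (r + u) - θ j)
      = (H j *ᵥ r - θ j) ⬝ᵥ (H j *ᵥ r - θ j)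
      + 2 * ((H j *ᵥ u) ⬝ᵥ (H j *ᵥ r) - (H j *ᵥ u) ⬝ᵥ θ j) + (H j *ᵥ u) ⬝ᵥ (H j *ᵥ u) := by
    intro j
    simp only [Matrix.mulVec_add, sub_dotProduct, dotProduct_sub, add_dotProduct, dotProduct_add]
    rw [dotProduct_comm (θ j) (H j *ᵥ u), dotProduct_comm (H j *ᵥ r) (H j *ᵥ u)]
    ring
  have e3 : u ⬝ᵥ ((Xᵀ * X + (n * α) • ∑ j, (H j)ᵀ * H j) *ᵥ r
          - (Xᵀ *ᵥ y + (n * α) • ∑ j, (H j)ᵀ *ᵥ θ j))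
      = ((X *ᵥ u) ⬝ᵥ (X *ᵥ r) - (X *ᵥ u) ⬝ᵥ y)
        + n * α * ∑ j, ((H j *ᵥ u) ⬝ᵥ (H j *ᵥ r) - (H j *ᵥ u) ⬝ᵥ θ j) := by
    simp only [Matrix.add_mulVec, Matrix.smul_mulVec, Matrix.sum_mulVec, dotProduct_sub,
      dotProduct_add, dotProduct_smul, dotProduct_sum, smul_eq_mul, ← Matrix.mulVec_mulVec, key,
      Finset.sum_sub_distrib]
    ring
  unfold transferObjective
  rw [e1, e3, Finset.sum_congr rfl fun j _ => e2 j]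
  simp only [Finset.sum_add_distrib, ← Finset.mul_sum]
  ring

/-- The closed form minimizes the transfer learning objective. -/
theorem transferEstimator_isMinimizer {d m n : ℕ} {α : ℝ} (hα : 0 < α)
    (H : Fin m → Matrix (Fin d) (Fin d) ℝ) (X : Matrix (Fin n) (Fin d) ℝ) (y : Fin n → ℝ)
    (θ : Fin m → Fin d → ℝ) (hdet : IsUnit (Xᵀ * X + (n * α) • ∑ j, (H j)ᵀ * H j).det)
    (r : Fin d → ℝ) :
    transferObjective α H X y θ (transferEstimator α H X y θ) ≤ transferObjective α H X y θ r := by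
  have h := transferObjective_add α H X y θ (transferEstimator α H X y θ)
    (r - transferEstimator α H X y θ)
  have h0 : (Xᵀ * X + (n * α) • ∑ j, (H j)ᵀ * H j) *ᵥ transferEstimator α H X y θ
      - (Xᵀ *ᵥ y + (n * α) • ∑ j, (H j)ᵀ *ᵥ θ j) = 0 := by
    rw [transferEstimator, Matrix.mulVec_mulVec, Matrix.mul_nonsing_inv _ hdet,
      Matrix.one_mulVec, sub_self]
  rw [h0, add_sub_cancel] at h
  have hsq : ∀ {p : ℕ} (v : Fin p → ℝ), 0 ≤ v ⬝ᵥ v := fun v =>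
    Finset.sum_nonneg fun i _ => mul_self_nonneg (v i)
  have h1 : 0 ≤ n * α * ∑ j, (H j *ᵥ (r - transferEstimator α H X y θ)) ⬝ᵥ
      (H j *ᵥ (r - transferEstimator α H X y θ)) :=
    mul_nonneg (by positivity) (Finset.sum_nonneg fun j _ => hsq _)
  rw [h, dotProduct_zero]
  linarith [hsq (X *ᵥ (r - transferEstimator α H X y θ))]

/-- Ridge regression is the case of one task with identity relation and zero estimate. -/
theorem ridgeEstimator_eq {d n : ℕ} (α : ℝ) (X : Matrix (Fin n) (Fin d) ℝ) (y : Fin n → ℝ) :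
    ridgeEstimator α X y = transferEstimator α (fun _ : Fin 1 => 1) X y 0 := by
  simp [ridgeEstimator, transferEstimator]

/-! Expected test errors, as extended nonnegative reals. -/

/-- Target training inputs. -/
def Sample.trainX {d m n k : ℕ} (w : Sample d m n k) : Matrix (Fin n) (Fin d) ℝ :=
  Matrix.of w.2.2.1.1

/-- Target training outputs `y = X β + ε`. -/
noncomputable def Sample.trainY {d m n k : ℕ} (w : Sample d m n k) : Fin n → ℝ :=
  w.trainX *ᵥ w.1 + w.2.2.1.2

/-- The squared prediction error at the test pair of the estimate `r`:
`(x_testᵀ r - y_test)²` with `y_test = x_testᵀ β + ε_test`. -/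
noncomputable def Sample.testLoss {d m n k : ℕ} (w : Sample d m n k) (r : Fin d → ℝ) : ℝ :=
  (w.2.2.2.1 ⬝ᵥ r - (w.2.2.2.1 ⬝ᵥ w.1 + w.2.2.2.2)) ^ 2

/-- Expected test error of transfer learning with hyperparameter `α`, with well-specified
task relations `H`, under the joint law `P` of all random elements. -/
noncomputable def transferError {d m n k : ℕ} (P : Measure (Sample d m n k))
    (H : Fin m → Matrix (Fin d) (Fin d) ℝ) (α : ℝ) : ℝ≥0∞ :=
  ∫⁻ w, ENNReal.ofReal (w.testLoss (transferEstimator α H w.trainX w.trainY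
    fun j => sourceEstimate (H j) w.1 (w.2.1 j))) ∂P

/-- Expected test error of ridge regression with hyperparameter `α`. -/
noncomputable def ridgeError {d m n k : ℕ} (P : Measure (Sample d m n k)) (α : ℝ) : ℝ≥0∞ :=
  ∫⁻ w, ENNReal.ofReal (w.testLoss (ridgeEstimator α w.trainX w.trainY)) ∂P

/-- The overparameterization factor: `1` if `k ≥ d`, and `k / d` if `k < d`. -/
noncomputable def overparamFactor (d k : ℕ) : ℝ := if d ≤ k then 1 else (k : ℝ) / d

/-!
Both estimators are ridge regressions shrinking towards a centre. Because `Hⱼᵀ Hⱼ = 1`, transfer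
learning with parameter `α` has total penalty `t = n α m` and its centre `g` is the average of the
pulled back source estimates `Hⱼᵀ θ̂ⱼ` (`transferEstimator_eq_centeredRidge`); ridge regression has
the centre `0`. With `B = (Xᵀ X + t)⁻¹` the estimation error is `B Xᵀ ε + t B (g - β)`
(`centeredRidge_sub`). If `g - β` has isotropic second moments with variance `q` per coordinate,
then the test error given `X` is an explicit function of `t` and `q`, strictly increasing in `q`
(`conditionalRisk`, `conditionalRisk_strictMono`). For ridge regression `q = b / d`, and the penalty
`t = σ² / q` is optimal for every realization of `X` (`conditionalRisk_optimal_le`): the excess risk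
of another penalty is a nonnegative multiple of the squared difference of the penalties. So it
suffices to see that the centre used by transfer learning has `q < b / d`, and to compare the two
errors at the penalty that is optimal for ridge regression.

For `q`, write `P = Z⁺ Z` for the projection onto the row space of a source matrix. The error
`Hᵀ θ̂ - β` is `-Hᵀ (1 - P) H β + Hᵀ P η + Hᵀ Z⁺ ξ`. Rotation invariance of `Z` makes the averages
of `P` and `Z⁺ Z⁺ᵀ` multiples of the identity (`integral_gaussianRows_isotropic`). Gaussian matrices
have full rank almost surely, so `P` averages to `ρ` (`ae_trace_rowProj`). The squared norm of a
column of `Z⁺` is at most that of any dual vector of the corresponding row; taking the projection of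
this row onto the orthogonal complement of the others, one is left with an inverse chi-squared
moment (`lintegral_pinv_col_le`, `lintegral_inv_sum_sq_gaussian`), and the average of `Z⁺ Z⁺ᵀ` is at
most `ρ / (|d - k| - 1)`. Summing over the independent sources gives `transferVariance`
(`transferCenter_sq_moment`), and the hypothesis says that it is below `b / d`
(`transferVariance_lt`).
-/

/-! ### Algebra and measurability of the pseudoinverse -/

theorem dotProduct_self_nonneg_real {q : ℕ} (v : Fin q → ℝ) : 0 ≤ v ⬝ᵥ v :=
  Finset.sum_nonneg fun i _ => mul_self_nonneg (v i)

theorem pinv_transpose {p q : ℕ} (A : Matrix (Fin p) (Fin q) ℝ) : pinv Aᵀ = (pinv A)ᵀ := by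
  have h := pinv_spec A
  refine (pinv_spec Aᵀ).unique ⟨?_, ?_, ?_, ?_⟩
  · rw [← Matrix.transpose_mul, ← Matrix.transpose_mul, ← Matrix.mul_assoc, h.mul_mul_self]
  · rw [← Matrix.transpose_mul, ← Matrix.transpose_mul, ← Matrix.mul_assoc, h.self_mul_mul]
  · rw [← Matrix.transpose_mul, h.symm_right, h.symm_right]
  · rw [← Matrix.transpose_mul, h.symm_left, h.symm_left]

/-- The pseudoinverse is equivariant under a rotation of the coordinates of the row space. -/
theorem pinv_mul_orthogonal {p q : ℕ} (A : Matrix (Fin p) (Fin q) ℝ)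
    {O : Matrix (Fin q) (Fin q) ℝ} (hO : O * Oᵀ = 1) : pinv (A * O) = Oᵀ * pinv A := by
  have h := pinv_spec A
  have e : A * O * (Oᵀ * pinv A) = A * pinv A := by
    rw [Matrix.mul_assoc, ← Matrix.mul_assoc O, hO, Matrix.one_mul]
  refine (pinv_spec (A * O)).unique ⟨?_, ?_, ?_, ?_⟩
  · rw [e, ← Matrix.mul_assoc, h.mul_mul_self]
  · rw [Matrix.mul_assoc, e, Matrix.mul_assoc, ← Matrix.mul_assoc (pinv A), h.self_mul_mul]
  · rw [e, h.symm_left]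
  · have : Oᵀ * pinv A * (A * O) = Oᵀ * (pinv A * A) * O := by simp only [Matrix.mul_assoc]
    rw [this, Matrix.transpose_mul, Matrix.transpose_mul, h.symm_right, Matrix.transpose_transpose,
      ← Matrix.mul_assoc]

/-- The orthogonal projection `A⁺ A` onto the row space of `A`. -/
noncomputable def rowProj {p q : ℕ} (A : Matrix (Fin p) (Fin q) ℝ) : Matrix (Fin q) (Fin q) ℝ :=
  pinv A * A

theorem rowProj_transpose {p q : ℕ} (A : Matrix (Fin p) (Fin q) ℝ) :
    (rowProj A)ᵀ = rowProj A := (pinv_spec A).symm_right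

theorem rowProj_mul_self {p q : ℕ} (A : Matrix (Fin p) (Fin q) ℝ) :
    rowProj A * rowProj A = rowProj A := by
  rw [rowProj, ← Matrix.mul_assoc, (pinv_spec A).self_mul_mul]

theorem rowProj_mul_orthogonal {p q : ℕ} (A : Matrix (Fin p) (Fin q) ℝ)
    {O : Matrix (Fin q) (Fin q) ℝ} (hO : O * Oᵀ = 1) :
    rowProj (A * O) = Oᵀ * rowProj A * O := by
  simp only [rowProj, pinv_mul_orthogonal A hO, Matrix.mul_assoc]

/-- Moving a matrix across the dot product. -/
theorem mulVec_dotProduct_eq {p q : ℕ} (A : Matrix (Fin p) (Fin q) ℝ) (u : Fin q → ℝ)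
    (v : Fin p → ℝ) : (A *ᵥ u) ⬝ᵥ v = u ⬝ᵥ (Aᵀ *ᵥ v) := by
  rw [Matrix.dotProduct_mulVec, Matrix.vecMul_transpose]

theorem rowProj_dotProduct {p q : ℕ} (A : Matrix (Fin p) (Fin q) ℝ) (u v : Fin q → ℝ) :
    (rowProj A *ᵥ u) ⬝ᵥ (rowProj A *ᵥ v) = u ⬝ᵥ (rowProj A *ᵥ v) := by
  rw [mulVec_dotProduct_eq, rowProj_transpose, Matrix.mulVec_mulVec, rowProj_mul_self]

/-- Pythagoras for the projection and its complement. -/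
theorem rowProj_pythagoras {p q : ℕ} (A : Matrix (Fin p) (Fin q) ℝ) (u : Fin q → ℝ) :
    (u - rowProj A *ᵥ u) ⬝ᵥ (u - rowProj A *ᵥ u) =
      u ⬝ᵥ u - (rowProj A *ᵥ u) ⬝ᵥ (rowProj A *ᵥ u) := by
  simp only [sub_dotProduct, dotProduct_sub, rowProj_dotProduct]
  rw [dotProduct_comm (rowProj A *ᵥ u) u]
  ring

theorem rowProj_dotProduct_self_le {p q : ℕ} (A : Matrix (Fin p) (Fin q) ℝ) (u : Fin q → ℝ) :
    (rowProj A *ᵥ u) ⬝ᵥ (rowProj A *ᵥ u) ≤ u ⬝ᵥ u := by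
  have := rowProj_pythagoras A u
  have := dotProduct_self_nonneg_real (u - rowProj A *ᵥ u)
  linarith

theorem mul_pinv_eq_one_of_linearIndependent {p q : ℕ} (A : Matrix (Fin p) (Fin q) ℝ)
    (h : LinearIndependent ℝ A.row) : A * pinv A = 1 := by
  have hinj : Function.Injective A.vecMul := Matrix.vecMul_injective_iff.2 h
  ext i j
  have : (A * pinv A) i = (1 : Matrix (Fin p) (Fin p) ℝ) i := by
    apply hinj
    show Matrix.vecMul ((A * pinv A) i) A = Matrix.vecMul ((1 : Matrix (Fin p) (Fin p) ℝ) i) A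
    have e : ∀ M : Matrix (Fin p) (Fin p) ℝ, Matrix.vecMul (M i) A = (M * A) i := fun M => by
      ext l; rfl
    rw [e, e, (pinv_spec A).mul_mul_self, Matrix.one_mul]
  rw [this]

/-- Column `i` of `A⁺` has minimal norm among the solutions of `A u = eᵢ`. -/
theorem pinv_col_dotProduct_le {p q : ℕ} (A : Matrix (Fin p) (Fin q) ℝ) (i : Fin p)
    (u : Fin q → ℝ) (hu : A *ᵥ u = Pi.single i 1) :
    ∑ l, pinv A l i ^ 2 ≤ u ⬝ᵥ u := by
  refine le_trans (le_of_eq ?_) (rowProj_dotProduct_self_le A u)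
  rw [rowProj, ← Matrix.mulVec_mulVec, hu]
  simp [dotProduct, sq]

theorem trace_rowProj_of_mul_pinv_eq_one {p q : ℕ} (A : Matrix (Fin p) (Fin q) ℝ)
    (h : A * pinv A = 1) : (rowProj A).trace = p := by
  rw [rowProj, Matrix.trace_mul_comm, h, Matrix.trace_one, Fintype.card_fin]

/-- `(Aᵀ A + t)⁻¹ Aᵀ → A⁺` as `t → 0+`, along `t = 1 / (N + 1)`. As a limit of rational functions,
the pseudoinverse is measurable, although it is not continuous. -/
theorem tendsto_ridge_pinv {p q : ℕ} (A : Matrix (Fin p) (Fin q) ℝ) (i : Fin q) (j : Fin p) :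
    Filter.Tendsto (fun N : ℕ => ((Aᵀ * A + (1 / ((N : ℝ) + 1)) • (1 : Matrix (Fin q) (Fin q) ℝ))⁻¹
      * Aᵀ) i j) Filter.atTop (nhds (pinv A i j)) := by
  have h := pinv_spec A
  set M := Aᵀ * A with hM
  -- `A⁺ = Aᵀ A S` puts `A⁺` into the range of `M`, where `t (M + t)⁻¹` tends to zero
  set S := pinv A * (pinv A)ᵀ * pinv A with hS
  have hA1 : M * pinv A = Aᵀ := by
    have := congrArg Matrix.transpose h.mul_mul_self
    rw [Matrix.transpose_mul, h.symm_left, ← Matrix.mul_assoc] at this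
    exact this
  have hA2 : M * S = pinv A := by
    rw [hS, ← Matrix.mul_assoc, ← Matrix.mul_assoc, hA1, ← Matrix.transpose_mul, h.symm_right,
      h.self_mul_mul]
  -- the error is `t (1 - t (M + t)⁻¹) S`, and `t (M + t)⁻¹` is a contraction
  have key : ∀ t : ℝ, 0 < t → |((M + t • (1 : Matrix (Fin q) (Fin q) ℝ))⁻¹ * Aᵀ) i j - pinv A i j|
      ≤ t * (|S i j| + ∑ l, S l j ^ 2 + 1) := by
    intro t ht
    set R := M + t • (1 : Matrix (Fin q) (Fin q) ℝ) with hR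
    have hpd : R.PosDef := by
      refine Matrix.PosDef.posSemidef_add ?_ ?_
      · simpa using Matrix.posSemidef_conjTranspose_mul_self A
      · exact Matrix.PosDef.one.smul ht
    have hu : IsUnit R.det := (Matrix.isUnit_iff_isUnit_det _).1 hpd.isUnit
    have e1 : R⁻¹ * Aᵀ = pinv A - t • (R⁻¹ * pinv A) := by
      have : Aᵀ = R * pinv A - t • pinv A := by
        rw [hR, Matrix.add_mul, hA1, Matrix.smul_mul, Matrix.one_mul, add_sub_cancel_right]
      rw [this, Matrix.mul_sub, ← Matrix.mul_assoc, Matrix.nonsing_inv_mul _ hu, Matrix.one_mul,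
        Matrix.mul_smul]
    have e2 : R⁻¹ * pinv A = S - t • (R⁻¹ * S) := by
      have : pinv A = R * S - t • S := by
        rw [hR, Matrix.add_mul, hA2, Matrix.smul_mul, Matrix.one_mul, add_sub_cancel_right]
      rw [this, Matrix.mul_sub, ← Matrix.mul_assoc, Matrix.nonsing_inv_mul _ hu, Matrix.one_mul,
        Matrix.mul_smul]
    have e3 : |t * (R⁻¹ * S) i j| ≤ ∑ l, S l j ^ 2 + 1 := by
      set y : Fin q → ℝ := fun l => (R⁻¹ * S) l j with hy
      have hRy : R *ᵥ y = fun l => S l j := by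
        have : R * (R⁻¹ * S) = S := by
          rw [← Matrix.mul_assoc, Matrix.mul_nonsing_inv _ hu, Matrix.one_mul]
        ext l
        have := congrFun (congrFun this l) j
        rw [← this]; rfl
      have hsum : ∑ l, S l j ^ 2 = (R *ᵥ y) ⬝ᵥ (R *ᵥ y) := by
        rw [hRy]; simp [dotProduct, sq]
      have hexp : (R *ᵥ y) ⬝ᵥ (R *ᵥ y) = (M *ᵥ y) ⬝ᵥ (M *ᵥ y) + 2 * t * ((A *ᵥ y) ⬝ᵥ (A *ᵥ y))
          + t ^ 2 * (y ⬝ᵥ y) := by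
        have hMy : (M *ᵥ y) ⬝ᵥ y = (A *ᵥ y) ⬝ᵥ (A *ᵥ y) := by
          rw [mulVec_dotProduct_eq A, Matrix.mulVec_mulVec, ← hM, dotProduct_comm]
        rw [hR, Matrix.add_mulVec, Matrix.smul_mulVec, Matrix.one_mulVec]
        simp only [add_dotProduct, dotProduct_add, smul_dotProduct, dotProduct_smul, smul_eq_mul]
        rw [dotProduct_comm y (M *ᵥ y), hMy]
        ring
      have h1 := dotProduct_self_nonneg_real (M *ᵥ y)
      have h2 := mul_nonneg (mul_nonneg zero_le_two ht.le) (dotProduct_self_nonneg_real (A *ᵥ y))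
      have h3 : y i ^ 2 ≤ y ⬝ᵥ y := by
        have := Finset.single_le_sum (f := fun l => y l * y l)
          (fun l _ => mul_self_nonneg (y l)) (Finset.mem_univ i)
        simpa [sq, dotProduct] using this
      have h4 : (t * y i) ^ 2 ≤ ∑ l, S l j ^ 2 := by
        rw [hsum, hexp, mul_pow]
        nlinarith [mul_le_mul_of_nonneg_left h3 (sq_nonneg t)]
      have h5 : |t * y i| ^ 2 ≤ ∑ l, S l j ^ 2 := by rwa [sq_abs]
      show |t * y i| ≤ _
      nlinarith [sq_nonneg (|t * y i| - 1), abs_nonneg (t * y i)]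
    have e4 : (R⁻¹ * Aᵀ) i j - pinv A i j = -(t * (S i j - t * (R⁻¹ * S) i j)) := by
      rw [e1, e2]; simp
    rw [e4, abs_neg, abs_mul, abs_of_pos ht, add_assoc]
    gcongr
    exact (abs_sub _ _).trans (by gcongr)
  rw [tendsto_iff_norm_sub_tendsto_zero]
  have hlim : Filter.Tendsto (fun N : ℕ => (1 / ((N : ℝ) + 1)) * (|S i j| + ∑ l, S l j ^ 2 + 1))
      Filter.atTop (nhds 0) := by
    simpa using (tendsto_one_div_add_atTop_nhds_zero_nat (𝕜 := ℝ)).mul_const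
      (|S i j| + ∑ l, S l j ^ 2 + 1)
  refine squeeze_zero (fun _ => norm_nonneg _) (fun N => ?_) hlim
  exact key _ (by positivity)

/-- The entries of the inverse of a matrix with measurable entries are measurable. -/
theorem measurable_inv_entry {Ω : Type*} [MeasurableSpace Ω] {q : ℕ}
    {F : Ω → Matrix (Fin q) (Fin q) ℝ} (hF : ∀ i j, Measurable fun w => F w i j) (i j : Fin q) :
    Measurable fun w => (F w)⁻¹ i j := by
  have hdet : ∀ G : Ω → Matrix (Fin q) (Fin q) ℝ, (∀ i j, Measurable fun w => G w i j) →
      Measurable fun w => (G w).det := by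
    intro G hG
    simp only [Matrix.det_apply]
    refine Finset.measurable_sum _ fun σ _ => ?_
    exact (Finset.measurable_prod _ fun l _ => hG _ _).const_smul _
  simp only [Matrix.inv_def, Matrix.smul_apply, Ring.inverse_eq_inv', smul_eq_mul]
  refine (hdet F hF).inv.mul ?_
  simp only [Matrix.adjugate_apply]
  refine hdet _ fun a b => ?_
  by_cases h : a = j
  · subst h; simp
  · simpa [Matrix.updateRow_ne h] using hF a b

theorem measurable_mul_entry {Ω : Type*} [MeasurableSpace Ω] {p q r : ℕ}
    {F : Ω → Matrix (Fin p) (Fin q) ℝ} {G : Ω → Matrix (Fin q) (Fin r) ℝ}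
    (hF : ∀ i j, Measurable fun w => F w i j) (hG : ∀ i j, Measurable fun w => G w i j)
    (i : Fin p) (j : Fin r) : Measurable fun w => (F w * G w) i j := by
  simp only [Matrix.mul_apply]
  exact Finset.measurable_sum _ fun l _ => (hF i l).mul (hG l j)

theorem measurable_mulVec_entry {Ω : Type*} [MeasurableSpace Ω] {p q : ℕ}
    {F : Ω → Matrix (Fin p) (Fin q) ℝ} {v : Ω → Fin q → ℝ}
    (hF : ∀ i j, Measurable fun w => F w i j) (hv : ∀ i, Measurable fun w => v w i)
    (i : Fin p) : Measurable fun w => (F w *ᵥ v w) i := by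
  simp only [Matrix.mulVec, dotProduct]
  exact Finset.measurable_sum _ fun l _ => (hF i l).mul (hv l)

theorem measurable_dotProduct {Ω : Type*} [MeasurableSpace Ω] {q : ℕ}
    {u v : Ω → Fin q → ℝ} (hu : ∀ i, Measurable fun w => u w i)
    (hv : ∀ i, Measurable fun w => v w i) : Measurable fun w => u w ⬝ᵥ v w := by
  simp only [dotProduct]
  exact Finset.measurable_sum _ fun l _ => (hu l).mul (hv l)

theorem measurable_pinv_entry {Ω : Type*} [MeasurableSpace Ω] {p q : ℕ}
    {F : Ω → Matrix (Fin p) (Fin q) ℝ} (hF : ∀ i j, Measurable fun w => F w i j)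
    (i : Fin q) (j : Fin p) : Measurable fun w => pinv (F w) i j := by
  refine measurable_of_tendsto_metrizable (f := fun (N : ℕ) w =>
    (((F w)ᵀ * F w + (1 / ((N : ℝ) + 1)) • (1 : Matrix (Fin q) (Fin q) ℝ))⁻¹ * (F w)ᵀ) i j)
    (fun N => ?_) ?_
  · refine measurable_mul_entry (fun a b => measurable_inv_entry (fun a b => ?_) a b)
      (fun a b => hF b a) i j
    simp only [Matrix.add_apply]
    exact (measurable_mul_entry (fun a b => hF b a) hF a b).add_const _
  · exact tendsto_pi_nhds.2 fun w => tendsto_ridge_pinv (F w) i j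

theorem measurable_rowProj_entry {Ω : Type*} [MeasurableSpace Ω] {p q : ℕ}
    {F : Ω → Matrix (Fin p) (Fin q) ℝ} (hF : ∀ i j, Measurable fun w => F w i j)
    (i j : Fin q) : Measurable fun w => rowProj (F w) i j :=
  measurable_mul_entry (measurable_pinv_entry hF) hF i j

/-! ### Inverse chi-squared moments and rotation invariance -/

/-- Laplace representation `1 / y = ∫₀^∞ exp (-t y) dt`, valid for `y = 0` in `[0, ∞]`. -/
theorem lintegral_exp_neg_mul_Ioi {y : ℝ} (hy : 0 ≤ y) :
    ∫⁻ t in Set.Ioi (0 : ℝ), ENNReal.ofReal (Real.exp (-(t * y))) = (ENNReal.ofReal y)⁻¹ := by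
  rcases hy.eq_or_lt with rfl | hy
  · simp
  · rw [← ofReal_integral_eq_lintegral_ofReal]
    · have h := integral_exp_mul_Ioi (a := -y) (by linarith) 0
      have : ∀ t : ℝ, Real.exp (-(t * y)) = Real.exp (-y * t) := fun t => by ring_nf
      simp only [this, h]
      rw [← ENNReal.ofReal_inv_of_pos hy]
      congr 1
      simp
    · have := integrableOn_exp_mul_Ioi (a := -y) (by linarith) 0
      refine this.congr_fun (fun t _ => ?_) measurableSet_Ioi
      ring_nf
    · exact Filter.Eventually.of_forall fun t => (Real.exp_pos _).le

theorem integral_exp_neg_mul_sq_gaussianReal {t : ℝ} (ht : 0 ≤ t) :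
    ∫ x, Real.exp (-(t * x ^ 2)) ∂gaussianReal 0 1 = (1 + 2 * t) ^ (-(1 / 2) : ℝ) := by
  rw [integral_gaussianReal_eq_integral_smul one_ne_zero]
  have h : ∀ x : ℝ, gaussianPDFReal 0 1 x • Real.exp (-(t * x ^ 2))
      = (√(2 * Real.pi))⁻¹ * Real.exp (-(1 / 2 + t) * x ^ 2) := by
    intro x
    simp only [gaussianPDFReal, smul_eq_mul, NNReal.coe_one, mul_one, sub_zero]
    rw [mul_assoc, ← Real.exp_add]
    congr 2
    ring
  simp only [h]
  rw [integral_const_mul, integral_gaussian, Real.rpow_neg (by positivity), ← Real.sqrt_eq_rpow,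
    ← Real.sqrt_inv, ← Real.sqrt_mul (by positivity), ← Real.sqrt_inv]
  congr 1
  have := Real.pi_pos
  field_simp

theorem lintegral_one_add_two_mul_rpow_Ioi {r : ℝ} (hr : 2 < r) :
    ∫⁻ t in Set.Ioi (0 : ℝ), ENNReal.ofReal ((1 + 2 * t) ^ (-(r / 2)))
      = ENNReal.ofReal (1 / (r - 2)) := by
  have hd : ∀ t ∈ Set.Ici (0 : ℝ), HasDerivAt
      (fun t : ℝ => (1 + 2 * t) ^ (1 - r / 2) * (-(1 / (r - 2)))) ((1 + 2 * t) ^ (-(r / 2))) t := by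
    intro t ht
    have ht : (0 : ℝ) ≤ t := ht
    have h1 : HasDerivAt (fun t : ℝ => 1 + 2 * t) 2 t := by
      simpa using ((hasDerivAt_id t).const_mul 2).const_add 1
    have h2 := (h1.rpow_const (p := 1 - r / 2) (Or.inl (by positivity))).mul_const (-(1 / (r - 2)))
    convert! h2 using 1
    have : r - 2 ≠ 0 := by linarith
    rw [show 1 - r / 2 - 1 = -(r / 2) by ring]
    field_simp
    ring
  have hpos : ∀ t ∈ Set.Ioi (0 : ℝ), 0 ≤ (1 + 2 * t) ^ (-(r / 2)) := by
    intro t ht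
    have ht : (0 : ℝ) < t := ht
    positivity
  have hlim : Filter.Tendsto (fun t : ℝ => (1 + 2 * t) ^ (1 - r / 2) * (-(1 / (r - 2))))
      Filter.atTop (nhds 0) := by
    have h1 := tendsto_rpow_neg_atTop (y := r / 2 - 1) (by linarith)
    have h2 : Filter.Tendsto (fun t : ℝ => 1 + 2 * t) Filter.atTop Filter.atTop :=
      Filter.tendsto_atTop_add_const_left _ _ (Filter.tendsto_id.const_mul_atTop two_pos)
    have h3 := (h1.comp h2).mul_const (-(1 / (r - 2)))
    simpa [Function.comp_def] using h3
  rw [← ofReal_integral_eq_lintegral_ofReal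
    (integrableOn_Ioi_deriv_of_nonneg' hd hpos hlim)
    ((ae_restrict_iff' measurableSet_Ioi).2 (Filter.Eventually.of_forall hpos)),
    integral_Ioi_of_hasDerivAt_of_nonneg' hd hpos hlim]
  congr 1
  simp

/-- The inverse moment of a chi-squared variable with `r > 2` degrees of freedom is
`1 / (r - 2)`. -/
theorem lintegral_inv_sum_sq_gaussian {p : ℕ} (s : Finset (Fin p)) (hs : 2 < s.card) :
    ∫⁻ x, (ENNReal.ofReal (∑ i ∈ s, x i ^ 2))⁻¹ ∂(Measure.pi fun _ : Fin p => gaussianReal 0 1)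
      = ENNReal.ofReal (1 / ((s.card : ℝ) - 2)) := by
  have h0 : ∀ x : Fin p → ℝ, 0 ≤ ∑ i ∈ s, x i ^ 2 := fun x =>
    Finset.sum_nonneg fun i _ => sq_nonneg _
  -- exchange the integrals: the Laplace transform of the squared norm factorizes
  simp only [← lintegral_exp_neg_mul_Ioi (h0 _)]
  rw [lintegral_lintegral_swap (by
    refine Measurable.aemeasurable ?_
    unfold Function.uncurry
    fun_prop)]
  rw [← lintegral_one_add_two_mul_rpow_Ioi (r := s.card) (by exact_mod_cast hs)]
  refine setLIntegral_congr_fun measurableSet_Ioi fun t ht => ?_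
  have ht : (0 : ℝ) < t := ht
  have hprod : ∀ x : Fin p → ℝ, Real.exp (-(t * ∑ i ∈ s, x i ^ 2))
      = ∏ i, (if i ∈ s then Real.exp (-(t * x i ^ 2)) else 1) := by
    intro x
    rw [Finset.prod_ite_mem, Finset.univ_inter, ← Real.exp_sum, Finset.mul_sum,
      Finset.sum_neg_distrib]
  have hint : ∫ x, Real.exp (-(t * ∑ i ∈ s, x i ^ 2))
      ∂(Measure.pi fun _ : Fin p => gaussianReal 0 1) = (1 + 2 * t) ^ (-((s.card : ℝ) / 2)) := by
    simp only [hprod]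
    rw [integral_fintype_prod_eq_prod (μ := fun _ : Fin p => gaussianReal 0 1)
      (f := fun i (y : ℝ) => if i ∈ s then Real.exp (-(t * y ^ 2)) else 1)]
    have : ∀ i, ∫ y, (if i ∈ s then Real.exp (-(t * y ^ 2)) else 1) ∂gaussianReal 0 1
        = if i ∈ s then (1 + 2 * t) ^ (-(1 / 2) : ℝ) else 1 := by
      intro i
      split_ifs
      · exact integral_exp_neg_mul_sq_gaussianReal ht.le
      · simp
    simp only [this, Finset.prod_ite_mem, Finset.univ_inter, Finset.prod_const]
    rw [← Real.rpow_natCast, ← Real.rpow_mul (by positivity)]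
    congr 1
    ring
  rw [← hint, ofReal_integral_eq_lintegral_ofReal]
  · refine Integrable.of_bound (C := 1) (by
      refine Measurable.aestronglyMeasurable ?_
      fun_prop) ?_
    refine Filter.Eventually.of_forall fun x => ?_
    rw [Real.norm_eq_abs, abs_of_pos (Real.exp_pos _), Real.exp_le_one_iff]
    have := mul_nonneg ht.le (h0 x)
    linarith
  · exact Filter.Eventually.of_forall fun x => (Real.exp_pos _).le

theorem isoGaussian_one (d : ℕ) :
    isoGaussian d 1 = Measure.pi fun _ : Fin d => gaussianReal 0 1 := by
  simp [isoGaussian]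

instance (d : ℕ) (s : ℝ) : IsProbabilityMeasure (isoGaussian d s) := by
  unfold isoGaussian; infer_instance

/-- The standard Gaussian law on `ℝ^p` is invariant under orthogonal matrices. -/
theorem measurePreserving_mulVec_isoGaussian {p : ℕ} {O : Matrix (Fin p) (Fin p) ℝ}
    (hO : Oᵀ * O = 1) :
    MeasurePreserving (fun x => O *ᵥ x) (isoGaussian p 1) (isoGaussian p 1) := by
  refine ⟨by fun_prop, ?_⟩
  rw [isoGaussian_one]
  have hon : Orthonormal ℝ fun i : Fin p => WithLp.toLp 2 (fun l => O l i) := by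
    rw [orthonormal_iff_ite]
    intro i j
    have := congrFun (congrFun hO i) j
    rw [Matrix.mul_apply, Matrix.one_apply] at this
    simpa [PiLp.inner_apply, mul_comm] using this
  let b : OrthonormalBasis (Fin p) ℝ (EuclideanSpace ℝ (Fin p)) :=
    OrthonormalBasis.mk hon (by
      rw [hon.linearIndependent.span_eq_top_of_card_eq_finrank' (by simp)])
  have h1 := stdGaussian_eq_map_pi_orthonormalBasis b
  rw [← map_pi_eq_stdGaussian] at h1
  have h2 := congrArg (Measure.map (WithLp.ofLp (p := 2) (V := Fin p → ℝ))) h1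
  rw [Measure.map_map (by fun_prop) (by fun_prop), Measure.map_map (by fun_prop)
    (Measurable.mono (by fun_prop) le_rfl le_rfl)] at h2
  have e1 : (WithLp.ofLp ∘ WithLp.toLp 2 : (Fin p → ℝ) → (Fin p → ℝ)) = id := rfl
  rw [e1, Measure.map_id] at h2
  refine Eq.trans ?_ h2.symm
  congr 1
  ext x l
  simp [b, Matrix.mulVec, dotProduct, mul_comm]

/-! ### Gaussian matrices: rank and inverse Wishart bound -/

/-- The law of a `q × p` matrix with i.i.d. standard Gaussian entries, given by its rows. -/
noncomputable def gaussianRows (q p : ℕ) : Measure (Fin q → Fin p → ℝ) :=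
  Measure.pi fun _ => isoGaussian p 1

instance (q p : ℕ) : IsProbabilityMeasure (gaussianRows q p) := by
  unfold gaussianRows; infer_instance

/-- For every subspace `K` of `ℝ^p` there is an orthogonal change of coordinates in which
`p - dim K` of the coordinates vanish on `K`. -/
theorem exists_orthogonal_adapted {p : ℕ} (K : Submodule ℝ (Fin p → ℝ)) :
    ∃ (O : Matrix (Fin p) (Fin p) ℝ) (s : Finset (Fin p)), Oᵀ * O = 1 ∧
      s.card = p - Module.finrank ℝ K ∧ ∀ i ∈ s, ∀ x ∈ K, (O *ᵥ x) i = 0 := by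
  let e := (WithLp.linearEquiv 2 ℝ (Fin p → ℝ)).symm
  let K' : Submodule ℝ (EuclideanSpace ℝ (Fin p)) := K.map e.toLinearMap
  have hK' : Module.finrank ℝ K' = Module.finrank ℝ K := LinearEquiv.finrank_map_eq e K
  have hr : Module.finrank ℝ K'ᗮ = p - Module.finrank ℝ K := by
    have := K'.finrank_add_finrank_orthogonal
    rw [finrank_euclideanSpace_fin, hK'] at this
    omega
  set r := Module.finrank ℝ K'ᗮ with hrdef
  let u := stdOrthonormalBasis ℝ K'ᗮ
  let v : Fin p → EuclideanSpace ℝ (Fin p) := fun i =>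
    if h : i.val < r then ((u ⟨i, h⟩ : K'ᗮ) : EuclideanSpace ℝ (Fin p)) else 0
  have hv : Orthonormal ℝ (Set.domRestrict {i : Fin p | i.val < r} v) := by
    have h1 : Orthonormal ℝ fun i => ((u i : K'ᗮ) : EuclideanSpace ℝ (Fin p)) :=
      u.orthonormal.comp_linearIsometry K'ᗮ.subtypeₗᵢ
    have h2 := h1.comp (fun i : {i : Fin p | i.val < r} => (⟨i.1.val, i.2⟩ : Fin r))
      (fun i j hij => by
        have := congrArg Fin.val hij
        exact Subtype.ext (Fin.ext this))
    convert! h2 using 1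
    ext i : 1
    have : i.1.val < r := i.2
    simp [v, this]
  obtain ⟨b, hb⟩ := hv.exists_orthonormalBasis_extension_of_card_eq (by simp)
  have hO : (Matrix.of fun i l => b i l) * (Matrix.of fun i l => b i l)ᵀ
      = (1 : Matrix (Fin p) (Fin p) ℝ) := by
    ext i j
    have := orthonormal_iff_ite.1 b.orthonormal i j
    rw [Matrix.mul_apply, Matrix.one_apply, ← this]
    simp [PiLp.inner_apply, mul_comm]
  refine ⟨Matrix.of fun i l => b i l, Finset.univ.filter fun i => i.val < r,
    mul_eq_one_comm.1 hO, ?_, ?_⟩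
  · have hrp : r ≤ p := by omega
    rw [← hr, Fin.card_filter_val_lt, min_eq_right hrp]
  · intro i hi x hx
    have hi : i.val < r := by simpa using hi
    have h1 : b i ∈ K'ᗮ := by
      rw [hb i hi]
      simp [v, hi]
    have h2 := K'.inner_left_of_mem_orthogonal (Submodule.mem_map_of_mem (f := e.toLinearMap) hx) h1
    rw [← h2]
    simp [PiLp.inner_apply, Matrix.mulVec, dotProduct, e, mul_comm]

theorem dotProduct_orthogonal {p : ℕ} {O : Matrix (Fin p) (Fin p) ℝ} (hO : Oᵀ * O = 1)
    (u v : Fin p → ℝ) : (O *ᵥ u) ⬝ᵥ (O *ᵥ v) = u ⬝ᵥ v := by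
  rw [mulVec_dotProduct_eq, Matrix.mulVec_mulVec, hO, Matrix.one_mulVec]

/-- A proper subspace is null for the standard Gaussian law. -/
theorem ae_notMem_submodule {p : ℕ} (K : Submodule ℝ (Fin p → ℝ)) (hK : Module.finrank ℝ K < p) :
    ∀ᵐ z ∂isoGaussian p 1, z ∉ K := by
  obtain ⟨O, s, hO, hs, hK0⟩ := exists_orthogonal_adapted K
  obtain ⟨i, hi⟩ := Finset.card_pos.1 (hs ▸ Nat.sub_pos_of_lt hK)
  have h1 : ∀ᵐ y ∂gaussianReal 0 1, y ≠ 0 := by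
    have : NullSingletonClass (gaussianReal 0 1) := nullSingletonClass_gaussianReal one_ne_zero
    simp [ae_iff]
  have h2 : ∀ᵐ z ∂isoGaussian p 1, z i ≠ 0 := by
    rw [isoGaussian_one]
    exact (measurePreserving_eval
      (fun _ : Fin p => gaussianReal 0 1) i).quasiMeasurePreserving.ae h1
  filter_upwards [(measurePreserving_mulVec_isoGaussian hO).quasiMeasurePreserving.ae h2]
    with z hz hzK using hz (hK0 i hi z hzK)

/-- The expected squared norm of the smallest vector `u ⟂ K` with `u ⬝ z = 1`, for Gaussian `z`:
this vector has squared norm `1 / ‖Q z‖ ^ 2`, where `Q` projects onto `Kᗮ`. -/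
theorem exists_dual_vector_bound {p : ℕ} (K : Submodule ℝ (Fin p → ℝ)) {r : ℕ} (hr : 2 < r)
    (hK : Module.finrank ℝ K + r ≤ p) :
    ∃ g : (Fin p → ℝ) → ℝ≥0∞, ∫⁻ z, g z ∂isoGaussian p 1 ≤ ENNReal.ofReal (1 / ((r : ℝ) - 2)) ∧
      ∀ z, g z ≠ ∞ → ∃ u : Fin p → ℝ, (∀ x ∈ K, x ⬝ᵥ u = 0) ∧ z ⬝ᵥ u = 1 ∧
        ENNReal.ofReal (u ⬝ᵥ u) ≤ g z := by
  obtain ⟨O, s, hO, hs, hK0⟩ := exists_orthogonal_adapted K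
  have hrs : r ≤ s.card := by omega
  refine ⟨fun z => (ENNReal.ofReal (∑ i ∈ s, (O *ᵥ z) i ^ 2))⁻¹, ?_, ?_⟩
  · rw [(measurePreserving_mulVec_isoGaussian hO).lintegral_comp
      (f := fun y => (ENNReal.ofReal (∑ i ∈ s, y i ^ 2))⁻¹) (by fun_prop), isoGaussian_one,
      lintegral_inv_sum_sq_gaussian s (by omega)]
    have h1 : (2 : ℝ) < r := by exact_mod_cast hr
    have h2 : (r : ℝ) ≤ s.card := by exact_mod_cast hrs
    exact ENNReal.ofReal_le_ofReal (one_div_le_one_div_of_le (by linarith) (by linarith))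
  · intro z hz
    set S := ∑ i ∈ s, (O *ᵥ z) i ^ 2 with hS
    have hSpos : 0 < S := by
      simpa using hz
    -- in the adapted coordinates, `u` is `Q z / ‖Q z‖ ^ 2`
    set w : Fin p → ℝ := fun i => if i ∈ s then (O *ᵥ z) i / S else 0 with hw
    have hOO : O * Oᵀ = 1 := mul_eq_one_comm.1 hO
    have hdot : ∀ x, x ⬝ᵥ (Oᵀ *ᵥ w) = (O *ᵥ x) ⬝ᵥ w := fun x => (mulVec_dotProduct_eq O x w).symm
    refine ⟨Oᵀ *ᵥ w, ?_, ?_, ?_⟩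
    · intro x hx
      rw [hdot]
      refine Finset.sum_eq_zero fun i _ => ?_
      by_cases hi : i ∈ s
      · rw [hK0 i hi x hx, zero_mul]
      · simp [hw, hi]
    · rw [hdot]
      have : (O *ᵥ z) ⬝ᵥ w = ∑ i ∈ s, (O *ᵥ z) i ^ 2 / S := by
        simp only [dotProduct, hw, mul_ite, mul_zero, Finset.sum_ite_mem, Finset.univ_inter]
        exact Finset.sum_congr rfl fun i _ => by ring
      rw [this, ← Finset.sum_div, ← hS, div_self hSpos.ne']
    · rw [hdot, Matrix.mulVec_mulVec, hOO, Matrix.one_mulVec]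
      have : w ⬝ᵥ w = ∑ i ∈ s, (O *ᵥ z) i ^ 2 / S ^ 2 := by
        simp only [dotProduct, hw, mul_ite, mul_zero, Finset.sum_ite_mem, Finset.univ_inter]
        refine Finset.sum_congr rfl fun i hi => ?_
        simp only [hi, if_true]
        ring
      rw [this, ← Finset.sum_div, ← hS, sq, div_self_mul_self', ENNReal.ofReal_inv_of_pos hSpos]

/-- The rows of a Gaussian matrix with at most as many rows as columns are almost surely linearly
independent. -/
theorem ae_linearIndependent_gaussianRows (p : ℕ) :
    ∀ q, q ≤ p → ∀ᵐ A ∂gaussianRows q p, LinearIndependent ℝ A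
  | 0, _ => Filter.Eventually.of_forall fun A => linearIndependent_empty_type
  | q + 1, hq => by
    have hmp := measurePreserving_piFinSuccAbove (fun _ : Fin (q + 1) => isoGaussian p 1) 0
    have key : ∀ᵐ x ∂((gaussianRows q p).prod (isoGaussian p 1)),
        LinearIndependent ℝ (Fin.cons x.2 x.1 : Fin (q + 1) → Fin p → ℝ) := by
      refine (Measure.ae_prod_iff_ae_ae ?_).2 ?_
      · have hc : Continuous fun x : (Fin q → Fin p → ℝ) × (Fin p → ℝ) =>
            (Fin.cons x.2 x.1 : Fin (q + 1) → Fin p → ℝ) := by fun_prop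
        exact (isOpen_setOfPred_linearIndependent.preimage hc).measurableSet
      · filter_upwards [ae_linearIndependent_gaussianRows p q (by omega)] with A hA
        have hdim : Module.finrank ℝ (Submodule.span ℝ (Set.range A)) < p := by
          rw [finrank_span_eq_card hA, Fintype.card_fin]
          omega
        filter_upwards [ae_notMem_submodule _ hdim] with z hz
        exact linearIndependent_finCons.2 ⟨hA, hz⟩
    have h2 := hmp.quasiMeasurePreserving.ae
      (Measure.measurePreserving_swap.quasiMeasurePreserving.ae key)
    filter_upwards [h2] with A hA
    convert! hA using 1
    exact (Fin.cons_self_tail A).symm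

/-- The transpose of a Gaussian matrix is Gaussian. -/
theorem measurePreserving_transpose (q p : ℕ) :
    MeasurePreserving (fun (A : Fin q → Fin p → ℝ) i j => A j i)
      (gaussianRows q p) (gaussianRows p q) := by
  have h : ∀ q p : ℕ, gaussianRows q p = (Measure.pi fun _ : Fin q × Fin p => gaussianReal 0 1).map
      (MeasurableEquiv.curry (Fin q) (Fin p) ℝ) := by
    intro q p
    have := Measure.infinitePi_map_curry (fun (_ : Fin q) (_ : Fin p) => gaussianReal 0 1)
    simp only [Measure.infinitePi_eq_pi] at this
    rw [this, gaussianRows, isoGaussian_one]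
  refine ⟨by fun_prop, ?_⟩
  rw [h q p, h p q, Measure.map_map (by fun_prop) (by fun_prop),
    ← (measurePreserving_piCongrLeft (fun _ : Fin p × Fin q => gaussianReal 0 1)
      (Equiv.prodComm (Fin q) (Fin p))).map_eq, Measure.map_map (by fun_prop) (by fun_prop)]
  congr 1

/-- Right multiplication by an orthogonal matrix preserves the law of a Gaussian matrix. -/
theorem measurePreserving_mul_orthogonal (q : ℕ) {p : ℕ} {O : Matrix (Fin p) (Fin p) ℝ}
    (hO : O * Oᵀ = 1) :
    MeasurePreserving (fun (A : Fin q → Fin p → ℝ) i => Oᵀ *ᵥ A i)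
      (gaussianRows q p) (gaussianRows q p) :=
  measurePreserving_pi _ _ fun _ =>
    measurePreserving_mulVec_isoGaussian (O := Oᵀ) (by rwa [Matrix.transpose_transpose])

theorem of_mulVec_rows {q p : ℕ} (A : Fin q → Fin p → ℝ) (O : Matrix (Fin p) (Fin p) ℝ) :
    (Matrix.of fun i => Oᵀ *ᵥ A i) = Matrix.of A * O := by
  ext i j
  simp [Matrix.mulVec, dotProduct, Matrix.mul_apply, mul_comm]

/-- Inverse Wishart bound: the expected squared norm of a column of the pseudoinverse of a
`q × p` Gaussian matrix with `q + 2 ≤ p` is at most `1 / (p - q - 1)`. -/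
theorem lintegral_pinv_col_le {q p : ℕ} (hqp : q + 2 ≤ p) (i : Fin q) :
    ∫⁻ A, ENNReal.ofReal (∑ l, pinv (Matrix.of A) l i ^ 2) ∂gaussianRows q p
      ≤ ENNReal.ofReal (1 / ((p : ℝ) - q - 1)) := by
  obtain ⟨q, rfl⟩ : ∃ q', q = q' + 1 := ⟨q - 1, by have := i.pos; omega⟩
  have hmp := (measurePreserving_piFinSuccAbove (fun _ : Fin (q + 1) => isoGaussian p 1) i).symm
  have hmeas : Measurable fun A : Fin (q + 1) → Fin p → ℝ =>
      ENNReal.ofReal (∑ l, pinv (Matrix.of A) l i ^ 2) := by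
    refine ENNReal.measurable_ofReal.comp (Finset.measurable_sum _ fun l _ => ?_)
    refine (measurable_pinv_entry (fun a b => ?_) l i).pow_const 2
    simp only [Matrix.of_apply]
    fun_prop
  unfold gaussianRows
  refine (hmp.lintegral_comp hmeas).symm.trans_le ?_
  refine (lintegral_prod_symm _ (hmeas.comp hmp.measurable).aemeasurable).trans_le ?_
  refine (lintegral_mono (g := fun _ => ENNReal.ofReal (1 / ((p : ℝ) - (q + 1 : ℕ) - 1)))
    fun R => ?_).trans (by simp)
  -- the other rows span a subspace `K` of dimension at most `q`
  have hK : Module.finrank ℝ (Submodule.span ℝ (Set.range R)) + (p - q) ≤ p := by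
    have := finrank_range_le_card (R := ℝ) R
    rw [Fintype.card_fin] at this
    change Module.finrank ℝ (Submodule.span ℝ (Set.range R)) ≤ q at this
    omega
  obtain ⟨g, hg, hgu⟩ := exists_dual_vector_bound _ (r := p - q) (by omega) hK
  refine (lintegral_mono fun z => ?_).trans (hg.trans (le_of_eq ?_))
  · by_cases hz : g z = ∞
    · rw [hz]; exact le_top
    · obtain ⟨u, hu0, hu1, hu2⟩ := hgu z hz
      refine le_trans (ENNReal.ofReal_le_ofReal (pinv_col_dotProduct_le _ i u ?_)) hu2
      ext j
      rcases Fin.eq_self_or_eq_succAbove i j with rfl | ⟨j', rfl⟩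
      · have e : (MeasurableEquiv.piFinSuccAbove (fun _ => Fin p → ℝ) j).symm (z, R) j = z :=
          Fin.insertNth_apply_same (α := fun _ => Fin p → ℝ) j z R
        rw [Pi.single_eq_same, ← hu1]
        exact congrArg (· ⬝ᵥ u) e
      · have e : (MeasurableEquiv.piFinSuccAbove (fun _ => Fin p → ℝ) i).symm (z, R)
            (i.succAbove j') = R j' :=
          Fin.insertNth_apply_succAbove (α := fun _ => Fin p → ℝ) i z R j'
        rw [Pi.single_eq_of_ne (Fin.succAbove_ne i j'),
          ← hu0 (R j') (Submodule.subset_span ⟨j', rfl⟩)]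
        exact congrArg (· ⬝ᵥ u) e
  · congr 2
    rw [Nat.cast_sub (by omega)]
    push_cast
    ring

/-! ### Norm of the pseudoinverse, dimension of the row space, isotropy -/

/-- The squared Frobenius norm of the pseudoinverse. -/
noncomputable def pinvSqNorm {q p : ℕ} (A : Matrix (Fin q) (Fin p) ℝ) : ℝ :=
  ∑ i, ∑ l, pinv A l i ^ 2

theorem pinvSqNorm_nonneg {q p : ℕ} (A : Matrix (Fin q) (Fin p) ℝ) : 0 ≤ pinvSqNorm A :=
  Finset.sum_nonneg fun _ _ => Finset.sum_nonneg fun _ _ => sq_nonneg _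

theorem measurable_of_entry {q p : ℕ} (a : Fin q) (b : Fin p) :
    Measurable fun A : Fin q → Fin p → ℝ => Matrix.of A a b := by
  simp only [Matrix.of_apply]
  fun_prop

theorem measurable_pinvSqNorm {q p : ℕ} :
    Measurable fun A : Fin q → Fin p → ℝ => pinvSqNorm (Matrix.of A) :=
  Finset.measurable_sum _ fun i _ => Finset.measurable_sum _ fun l _ =>
    (measurable_pinv_entry measurable_of_entry l i).pow_const 2

theorem pinvSqNorm_transpose {q p : ℕ} (A : Matrix (Fin q) (Fin p) ℝ) :
    pinvSqNorm Aᵀ = pinvSqNorm A := by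
  simp only [pinvSqNorm, pinv_transpose, Matrix.transpose_apply]
  exact Finset.sum_comm

theorem lintegral_pinvSqNorm_le {q p : ℕ} (hqp : q + 2 ≤ p) :
    ∫⁻ A, ENNReal.ofReal (pinvSqNorm (Matrix.of A)) ∂gaussianRows q p
      ≤ ENNReal.ofReal (q / ((p : ℝ) - q - 1)) := by
  have h : ∀ A : Fin q → Fin p → ℝ, ENNReal.ofReal (pinvSqNorm (Matrix.of A))
      = ∑ i, ENNReal.ofReal (∑ l, pinv (Matrix.of A) l i ^ 2) := fun A =>
    ENNReal.ofReal_sum_of_nonneg fun _ _ => Finset.sum_nonneg fun _ _ => sq_nonneg _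
  simp only [h]
  have hm : ∀ i ∈ Finset.univ, Measurable fun A : Fin q → Fin p → ℝ =>
      ENNReal.ofReal (∑ l, pinv (Matrix.of A) l i ^ 2) := fun i _ =>
    ENNReal.measurable_ofReal.comp (Finset.measurable_sum _
      fun l _ => (measurable_pinv_entry measurable_of_entry l i).pow_const 2)
  rw [lintegral_finsetSum _ hm]
  refine (Finset.sum_le_sum fun i _ => lintegral_pinv_col_le hqp i).trans ?_
  have hpos : (0 : ℝ) ≤ 1 / ((p : ℝ) - q - 1) := by
    have : (q : ℝ) + 2 ≤ p := by exact_mod_cast hqp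
    exact one_div_nonneg.2 (by linarith)
  rw [← ENNReal.ofReal_sum_of_nonneg fun _ _ => hpos]
  simp [div_eq_mul_inv]

theorem overparamFactor_pos {d k : ℕ} (hd : 0 < d) (hk : 0 < k) : 0 < overparamFactor d k := by
  unfold overparamFactor
  split_ifs <;> positivity

theorem one_le_abs_sub_sub_one {d k : ℕ} (h₁ : d + 1 ≠ k) (h₂ : d ≠ k) (h₃ : d ≠ k + 1) :
    1 ≤ |(d : ℝ) - k| - 1 := by
  rcases Nat.lt_or_gt_of_ne h₂ with h | h
  · have : (d : ℝ) + 2 ≤ k := by exact_mod_cast (show d + 2 ≤ k by omega)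
    rw [abs_of_neg (by linarith)]; linarith
  · have : (k : ℝ) + 2 ≤ d := by exact_mod_cast (show k + 2 ≤ d by omega)
    rw [abs_of_pos (by linarith)]; linarith

/-- The inverse Wishart bound in both regimes. For `d < k` it is applied to the transpose of the
matrix, which has more columns than rows. -/
theorem lintegral_pinvSqNorm_le_overparamFactor {d k : ℕ} (hd : 0 < d) (h₁ : d + 1 ≠ k) (h₂ : d ≠ k)
    (h₃ : d ≠ k + 1) :
    ∫⁻ Z, ENNReal.ofReal (pinvSqNorm (Matrix.of Z)) ∂gaussianRows k d
      ≤ ENNReal.ofReal (d * (overparamFactor d k / (|(d : ℝ) - k| - 1))) := by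
  unfold overparamFactor
  rcases Nat.lt_or_gt_of_ne h₂ with h | h
  · have hd2 : (d : ℝ) + 2 ≤ k := by exact_mod_cast (show d + 2 ≤ k by omega)
    have e : ∀ Z : Fin k → Fin d → ℝ, pinvSqNorm (Matrix.of Z)
        = pinvSqNorm (Matrix.of fun i j => Z j i) := fun Z => by
      rw [← pinvSqNorm_transpose]; rfl
    simp only [e]
    rw [(measurePreserving_transpose k d).lintegral_comp
      (f := fun A => ENNReal.ofReal (pinvSqNorm (Matrix.of A)))
      (ENNReal.measurable_ofReal.comp measurable_pinvSqNorm)]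
    refine (lintegral_pinvSqNorm_le (by omega)).trans (le_of_eq ?_)
    rw [if_pos h.le, abs_of_neg (by linarith)]
    congr 1
    ring
  · have hd2 : (k : ℝ) + 2 ≤ d := by exact_mod_cast (show k + 2 ≤ d by omega)
    refine (lintegral_pinvSqNorm_le (by omega)).trans (le_of_eq ?_)
    rw [if_neg (by omega), abs_of_pos (by linarith)]
    congr 1
    field_simp

theorem integrable_pinvSqNorm {d k : ℕ} (hd : 0 < d) (h₁ : d + 1 ≠ k) (h₂ : d ≠ k)
    (h₃ : d ≠ k + 1) :
    Integrable (fun Z : Fin k → Fin d → ℝ => pinvSqNorm (Matrix.of Z)) (gaussianRows k d) := by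
  refine ⟨measurable_pinvSqNorm.aestronglyMeasurable, ?_⟩
  rw [hasFiniteIntegral_iff_ofReal (Filter.Eventually.of_forall fun _ => pinvSqNorm_nonneg _)]
  exact (lintegral_pinvSqNorm_le_overparamFactor hd h₁ h₂ h₃).trans_lt ENNReal.ofReal_lt_top

theorem integral_pinvSqNorm_le {d k : ℕ} (hd : 0 < d) (h₁ : d + 1 ≠ k) (h₂ : d ≠ k)
    (h₃ : d ≠ k + 1) :
    ∫ Z, pinvSqNorm (Matrix.of Z) ∂gaussianRows k d
      ≤ d * (overparamFactor d k / (|(d : ℝ) - k| - 1)) := by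
  have h0 : 0 ≤ overparamFactor d k := by unfold overparamFactor; split_ifs <;> positivity
  have h4 := one_le_abs_sub_sub_one h₁ h₂ h₃
  rw [← ENNReal.ofReal_le_ofReal_iff (by positivity),
    ofReal_integral_eq_lintegral_ofReal (integrable_pinvSqNorm hd h₁ h₂ h₃)
      (Filter.Eventually.of_forall fun _ => pinvSqNorm_nonneg _)]
  exact lintegral_pinvSqNorm_le_overparamFactor hd h₁ h₂ h₃

/-- The rank of a Gaussian matrix is almost surely maximal, so its row space has dimension
`min k d = d ρ`. -/
theorem ae_trace_rowProj {d k : ℕ} (hd : 0 < d) :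
    ∀ᵐ Z ∂gaussianRows k d, (rowProj (Matrix.of Z)).trace = d * overparamFactor d k := by
  unfold overparamFactor
  split_ifs with h
  · have h1 := (measurePreserving_transpose k d).quasiMeasurePreserving.ae
      (ae_linearIndependent_gaussianRows k d h)
    filter_upwards [h1] with Z hZ
    have h2 : (Matrix.of Z)ᵀ * pinv (Matrix.of Z)ᵀ = 1 :=
      mul_pinv_eq_one_of_linearIndependent _ hZ
    have h3 : rowProj (Matrix.of Z) = 1 := by
      rw [← rowProj_transpose, rowProj, Matrix.transpose_mul, ← pinv_transpose, h2]
    rw [h3, Matrix.trace_one, Fintype.card_fin, mul_one]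
  · filter_upwards [ae_linearIndependent_gaussianRows d k (by omega)] with Z hZ
    rw [trace_rowProj_of_mul_pinv_eq_one (Matrix.of Z) (mul_pinv_eq_one_of_linearIndependent _ hZ)]
    field_simp

/-- Two vectors of the same norm are exchanged by a Householder reflection. -/
theorem exists_orthogonal_mulVec_eq {d : ℕ} (a b : Fin d → ℝ) (h : a ⬝ᵥ a = b ⬝ᵥ b) :
    ∃ O : Matrix (Fin d) (Fin d) ℝ, O * Oᵀ = 1 ∧ O *ᵥ a = b := by
  by_cases hab : a = b
  · exact ⟨1, by simp, by simp [hab]⟩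
  set w := a - b with hw
  have hw0 : w ⬝ᵥ w ≠ 0 := fun h0 => hab (sub_eq_zero.1 (dotProduct_self_eq_zero.1 h0))
  have hwa : 2 * (w ⬝ᵥ a) = w ⬝ᵥ w := by
    simp only [hw, sub_dotProduct, dotProduct_sub]
    rw [dotProduct_comm b a, h]
    ring
  refine ⟨1 - (2 / (w ⬝ᵥ w)) • Matrix.vecMulVec w w, ?_, ?_⟩
  · have ht : (Matrix.vecMulVec w w)ᵀ = Matrix.vecMulVec w w := by
      ext i j; simp [Matrix.vecMulVec_apply, mul_comm]
    have hs : Matrix.vecMulVec w w * Matrix.vecMulVec w w = (w ⬝ᵥ w) • Matrix.vecMulVec w w := by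
      rw [Matrix.vecMulVec_mul_vecMulVec]
      ext i j
      simp [Matrix.vecMulVec_apply]
      ring
    rw [Matrix.transpose_sub, Matrix.transpose_smul, ht, Matrix.transpose_one, Matrix.sub_mul,
      Matrix.one_mul, Matrix.mul_sub, Matrix.mul_one, Matrix.smul_mul,
      Matrix.mul_smul, hs, smul_smul, smul_smul]
    ext i j
    simp only [Matrix.sub_apply, Matrix.smul_apply, smul_eq_mul]
    field_simp
    ring
  · have : Matrix.vecMulVec w w *ᵥ a = (w ⬝ᵥ a) • w := by
      ext i
      simp [Matrix.vecMulVec_mulVec, mul_comm]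
    rw [Matrix.sub_mulVec, Matrix.one_mulVec, Matrix.smul_mulVec, this, smul_smul,
      show 2 / (w ⬝ᵥ w) * (w ⬝ᵥ a) = 1 by rw [div_mul_eq_mul_div, hwa, div_self hw0], one_smul, hw]
    abel

/-- An orthogonally invariant, quadratically homogeneous function is a multiple of the squared
norm. -/
theorem eq_of_orthogonal_invariant {d : ℕ} (Q : (Fin d → ℝ) → ℝ)
    (hO : ∀ O : Matrix (Fin d) (Fin d) ℝ, O * Oᵀ = 1 → ∀ a, Q (O *ᵥ a) = Q a)
    (hs : ∀ (t : ℝ) a, Q (t • a) = t ^ 2 * Q a) (a : Fin d → ℝ) :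
    d * Q a = (a ⬝ᵥ a) * ∑ i, Q (Pi.single i 1) := by
  have h : ∀ i, Q a = (a ⬝ᵥ a) * Q (Pi.single i 1) := by
    intro i
    obtain ⟨O, h1, h2⟩ := exists_orthogonal_mulVec_eq a (√(a ⬝ᵥ a) • Pi.single i 1) (by
      simp [Real.mul_self_sqrt (dotProduct_self_nonneg_real a)])
    rw [← hO O h1 a, h2, hs, Real.sq_sqrt (dotProduct_self_nonneg_real a)]
  rw [Finset.mul_sum, ← Finset.sum_congr rfl fun i _ => h i]
  simp

/-- An average over a Gaussian matrix of an orthogonally equivariant quadratic form. -/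
theorem integral_gaussianRows_isotropic {d k : ℕ} (F : Matrix (Fin k) (Fin d) ℝ → (Fin d → ℝ) → ℝ)
    (hm : ∀ a, Measurable fun Z : Fin k → Fin d → ℝ => F (Matrix.of Z) a)
    (hO : ∀ O : Matrix (Fin d) (Fin d) ℝ, O * Oᵀ = 1 → ∀ Z a, F (Z * O) a = F Z (O *ᵥ a))
    (hs : ∀ Z (t : ℝ) a, F Z (t • a) = t ^ 2 * F Z a)
    (hi : ∀ i, Integrable (fun Z : Fin k → Fin d → ℝ => F (Matrix.of Z) (Pi.single i 1))
      (gaussianRows k d)) (a : Fin d → ℝ) :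
    d * ∫ Z, F (Matrix.of Z) a ∂gaussianRows k d
      = (a ⬝ᵥ a) * ∫ Z, ∑ i, F (Matrix.of Z) (Pi.single i 1) ∂gaussianRows k d := by
  rw [integral_finsetSum _ fun i _ => hi i]
  refine eq_of_orthogonal_invariant (fun a => ∫ Z, F (Matrix.of Z) a ∂gaussianRows k d) ?_ ?_ a
  · intro O h1 a
    have hmp := measurePreserving_mul_orthogonal k h1
    have := integral_map (μ := gaussianRows k d) hmp.measurable.aemeasurable
      (f := fun Z => F (Matrix.of Z) a) (hm a).aestronglyMeasurable
    rw [hmp.map_eq] at this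
    rw [this]
    refine integral_congr_ae (Filter.Eventually.of_forall fun Z => ?_)
    simp only [of_mulVec_rows, hO O h1]
  · intro t a
    simp only [hs, integral_const_mul]

/-! ### Moments of the row projection and of the pseudoinverse -/

theorem measurable_rowProj_dotProduct {d k : ℕ} (a : Fin d → ℝ) :
    Measurable fun Z : Fin k → Fin d → ℝ =>
      (rowProj (Matrix.of Z) *ᵥ a) ⬝ᵥ (rowProj (Matrix.of Z) *ᵥ a) :=
  have h := measurable_mulVec_entry (measurable_rowProj_entry measurable_of_entry)
    (v := fun _ : Fin k → Fin d → ℝ => a) fun _ => measurable_const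
  measurable_dotProduct h h

theorem integrable_rowProj_dotProduct {d k : ℕ} (a : Fin d → ℝ) :
    Integrable (fun Z : Fin k → Fin d → ℝ =>
      (rowProj (Matrix.of Z) *ᵥ a) ⬝ᵥ (rowProj (Matrix.of Z) *ᵥ a)) (gaussianRows k d) := by
  refine Integrable.of_bound (C := a ⬝ᵥ a) (measurable_rowProj_dotProduct a).aestronglyMeasurable
    (Filter.Eventually.of_forall fun Z => ?_)
  rw [Real.norm_of_nonneg (dotProduct_self_nonneg_real _)]
  exact rowProj_dotProduct_self_le _ a

/-- The row space is isotropic and has dimension `d ρ`, so projecting onto it shrinks the squared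
norm by the factor `ρ` on average. -/
theorem integral_rowProj_dotProduct_self {d k : ℕ} (hd : 0 < d) (a : Fin d → ℝ) :
    ∫ Z, (rowProj (Matrix.of Z) *ᵥ a) ⬝ᵥ (rowProj (Matrix.of Z) *ᵥ a) ∂gaussianRows k d
      = overparamFactor d k * (a ⬝ᵥ a) := by
  have h := integral_gaussianRows_isotropic (k := k)
    (fun Z a => (rowProj Z *ᵥ a) ⬝ᵥ (rowProj Z *ᵥ a)) measurable_rowProj_dotProduct ?_ ?_
    (fun i => integrable_rowProj_dotProduct _) a
  · have h1 : ∫ Z, ∑ i, (rowProj (Matrix.of Z) *ᵥ Pi.single i 1) ⬝ᵥ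
        (rowProj (Matrix.of Z) *ᵥ Pi.single i 1) ∂gaussianRows k d = d * overparamFactor d k := by
      rw [integral_congr_ae (g := fun _ => (d : ℝ) * overparamFactor d k)]
      · simp
      · filter_upwards [ae_trace_rowProj (k := k) hd] with Z hZ
        rw [← hZ]
        simp only [rowProj_dotProduct, single_one_dotProduct]
        simp [Matrix.trace]
    rw [h1] at h
    have hd' : (d : ℝ) ≠ 0 := by positivity
    exact mul_left_cancel₀ hd' (by rw [h]; ring)
  · intro O hO Z a
    simp only [rowProj_mul_orthogonal Z hO, ← Matrix.mulVec_mulVec]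
    exact dotProduct_orthogonal (by rwa [Matrix.transpose_transpose]) _ _
  · intro Z t a
    simp only [Matrix.mulVec_smul, smul_dotProduct, dotProduct_smul, smul_eq_mul]
    ring

theorem integrable_rowProj_mulVec {d k : ℕ} (a : Fin d → ℝ) (i : Fin d) :
    Integrable (fun Z : Fin k → Fin d → ℝ => (rowProj (Matrix.of Z) *ᵥ a) i)
      (gaussianRows k d) := by
  refine Integrable.of_bound (C := a ⬝ᵥ a + 1) (measurable_mulVec_entry
    (measurable_rowProj_entry measurable_of_entry) (v := fun _ => a) (fun _ => measurable_const)
    i).aestronglyMeasurable (Filter.Eventually.of_forall fun Z => ?_)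
  have h1 := rowProj_dotProduct_self_le (Matrix.of Z) a
  have h2 := Finset.single_le_sum
    (f := fun l => (rowProj (Matrix.of Z) *ᵥ a) l * (rowProj (Matrix.of Z) *ᵥ a) l)
    (fun l _ => mul_self_nonneg _) (Finset.mem_univ i)
  change _ ≤ (rowProj (Matrix.of Z) *ᵥ a) ⬝ᵥ (rowProj (Matrix.of Z) *ᵥ a) at h2
  rw [Real.norm_eq_abs]
  have h3 := abs_mul_abs_self ((rowProj (Matrix.of Z) *ᵥ a) i)
  nlinarith [sq_nonneg (|(rowProj (Matrix.of Z) *ᵥ a) i| - 1),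
    abs_nonneg ((rowProj (Matrix.of Z) *ᵥ a) i)]

/-- The mean of the projection onto the row space is `ρ I`, by polarization. -/
theorem integral_rowProj_mulVec {d k : ℕ} (hd : 0 < d) (a : Fin d → ℝ) (i : Fin d) :
    ∫ Z, (rowProj (Matrix.of Z) *ᵥ a) i ∂gaussianRows k d = overparamFactor d k * a i := by
  set e : Fin d → ℝ := Pi.single i 1 with he
  have hpol : ∀ Z : Fin k → Fin d → ℝ, (rowProj (Matrix.of Z) *ᵥ a) i
      = ((rowProj (Matrix.of Z) *ᵥ (a + e)) ⬝ᵥ (rowProj (Matrix.of Z) *ᵥ (a + e))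
        - (rowProj (Matrix.of Z) *ᵥ a) ⬝ᵥ (rowProj (Matrix.of Z) *ᵥ a)
        - (rowProj (Matrix.of Z) *ᵥ e) ⬝ᵥ (rowProj (Matrix.of Z) *ᵥ e)) / 2 := by
    intro Z
    have h1 : (rowProj (Matrix.of Z) *ᵥ e) ⬝ᵥ (rowProj (Matrix.of Z) *ᵥ a)
        = (rowProj (Matrix.of Z) *ᵥ a) i := by
      rw [rowProj_dotProduct, he, single_one_dotProduct]
    rw [Matrix.mulVec_add]
    simp only [add_dotProduct, dotProduct_add]
    rw [dotProduct_comm (rowProj (Matrix.of Z) *ᵥ a) (rowProj (Matrix.of Z) *ᵥ e), h1]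
    ring
  simp only [hpol]
  have hi := integrable_rowProj_dotProduct (d := d) (k := k)
  rw [integral_div, integral_sub, integral_sub (hi _) (hi _)]
  rotate_left
  · exact (hi (a + e)).sub (hi a)
  · exact hi e
  simp only [integral_rowProj_dotProduct_self hd]
  have h1 : a ⬝ᵥ e = a i := by rw [he, dotProduct_single_one]
  simp only [add_dotProduct, dotProduct_add]
  rw [dotProduct_comm e a, h1]
  ring

theorem measurable_pinv_transpose_dotProduct {d k : ℕ} (a : Fin d → ℝ) :
    Measurable fun Z : Fin k → Fin d → ℝ =>
      ((pinv (Matrix.of Z))ᵀ *ᵥ a) ⬝ᵥ ((pinv (Matrix.of Z))ᵀ *ᵥ a) :=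
  have h := measurable_mulVec_entry (F := fun Z : Fin k → Fin d → ℝ => (pinv (Matrix.of Z))ᵀ)
    (fun i j => measurable_pinv_entry measurable_of_entry j i)
    (v := fun _ : Fin k → Fin d → ℝ => a) fun _ => measurable_const
  measurable_dotProduct h h

theorem pinv_transpose_dotProduct_le {d k : ℕ} (A : Matrix (Fin k) (Fin d) ℝ) (a : Fin d → ℝ) :
    ((pinv A)ᵀ *ᵥ a) ⬝ᵥ ((pinv A)ᵀ *ᵥ a) ≤ pinvSqNorm A * (a ⬝ᵥ a) := by
  rw [pinvSqNorm, Finset.sum_mul]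
  refine Finset.sum_le_sum fun i _ => ?_
  have := Finset.sum_mul_sq_le_sq_mul_sq Finset.univ (fun l => pinv A l i) a
  simpa [Matrix.mulVec, dotProduct, sq] using this

theorem integrable_pinv_transpose_dotProduct {d k : ℕ} (hd : 0 < d) (h₁ : d + 1 ≠ k) (h₂ : d ≠ k)
    (h₃ : d ≠ k + 1) (a : Fin d → ℝ) :
    Integrable (fun Z : Fin k → Fin d → ℝ =>
      ((pinv (Matrix.of Z))ᵀ *ᵥ a) ⬝ᵥ ((pinv (Matrix.of Z))ᵀ *ᵥ a)) (gaussianRows k d) := by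
  refine ((integrable_pinvSqNorm hd h₁ h₂ h₃).mul_const (a ⬝ᵥ a)).mono'
    (measurable_pinv_transpose_dotProduct a).aestronglyMeasurable
    (Filter.Eventually.of_forall fun Z => ?_)
  rw [Real.norm_of_nonneg (dotProduct_self_nonneg_real _)]
  exact pinv_transpose_dotProduct_le _ a

/-- The mean of `Z⁺ Z⁺ᵀ` is a multiple of the identity; its trace is the inverse Wishart moment. -/
theorem integral_pinv_transpose_dotProduct_le {d k : ℕ} (hd : 0 < d) (h₁ : d + 1 ≠ k)
    (h₂ : d ≠ k) (h₃ : d ≠ k + 1) (a : Fin d → ℝ) :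
    ∫ Z, ((pinv (Matrix.of Z))ᵀ *ᵥ a) ⬝ᵥ ((pinv (Matrix.of Z))ᵀ *ᵥ a) ∂gaussianRows k d
      ≤ overparamFactor d k / (|(d : ℝ) - k| - 1) * (a ⬝ᵥ a) := by
  have h := integral_gaussianRows_isotropic (k := k)
    (fun Z a => ((pinv Z)ᵀ *ᵥ a) ⬝ᵥ ((pinv Z)ᵀ *ᵥ a)) measurable_pinv_transpose_dotProduct ?_ ?_
    (fun i => integrable_pinv_transpose_dotProduct hd h₁ h₂ h₃ _) a
  · have h1 : ∀ Z : Fin k → Fin d → ℝ, ∑ i, ((pinv (Matrix.of Z))ᵀ *ᵥ Pi.single i 1) ⬝ᵥ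
        ((pinv (Matrix.of Z))ᵀ *ᵥ Pi.single i 1) = pinvSqNorm (Matrix.of Z) := by
      intro Z
      rw [pinvSqNorm, Finset.sum_comm]
      simp [dotProduct, sq]
    simp only [h1] at h
    have h2 := mul_le_mul_of_nonneg_left (integral_pinvSqNorm_le hd h₁ h₂ h₃)
      (dotProduct_self_nonneg_real a)
    have hd' : (0 : ℝ) < d := by positivity
    refine le_of_mul_le_mul_left ?_ hd'
    rw [h]
    linarith
  · intro O hO Z a
    simp only [pinv_mul_orthogonal Z hO, Matrix.transpose_mul, Matrix.transpose_transpose,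
      ← Matrix.mulVec_mulVec]
  · intro Z t a
    simp only [Matrix.mulVec_smul, smul_dotProduct, dotProduct_smul, smul_eq_mul]
    ring

/-! ### Second moments of isotropic vectors -/

/-- A vector of i.i.d. centred entries of variance `σ²` is isotropic. -/
theorem IsNoiseLaw.pi {μ : Measure ℝ} {σ : ℝ} (h : IsNoiseLaw μ σ) (q : ℕ) :
    IsIsotropicInputLaw (Measure.pi fun _ : Fin q => μ) (σ ^ 2) := by
  have := h.isProbabilityMeasure
  have hmp := fun k => measurePreserving_eval (fun _ : Fin q => μ) k
  have hint : ∀ (k : Fin q) (f : ℝ → ℝ), AEStronglyMeasurable f μ →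
      ∫ x, f (x k) ∂(Measure.pi fun _ : Fin q => μ) = ∫ t, f t ∂μ := by
    intro k f hf
    rw [← (hmp k).map_eq] at hf
    have := integral_map (hmp k).measurable.aemeasurable hf
    rw [(hmp k).map_eq] at this
    exact this.symm
  refine ⟨inferInstance, fun k => h.memLp.comp_measurePreserving (hmp k), fun k => ?_,
    fun k l => ?_⟩
  · rw [hint k (fun t => t) measurable_id.aestronglyMeasurable, h.mean_zero]
  · by_cases hkl : k = l
    · subst hkl
      have := hint k (fun t => t ^ 2) (by fun_prop)
      rw [h.variance_eq] at this
      simpa [← sq] using this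
    · have hind : IndepFun (fun x : Fin q → ℝ => x k) (fun x => x l)
          (Measure.pi fun _ : Fin q => μ) :=
        (iIndepFun_pi (μ := fun _ : Fin q => μ) (X := fun _ t => t)
          fun _ => measurable_id.aemeasurable).indepFun hkl
      have := hind.integral_mul_eq_mul_integral
        (measurable_pi_apply k).aestronglyMeasurable (measurable_pi_apply l).aestronglyMeasurable
      simp only [Pi.mul_apply] at this
      rw [this, hint k (fun t => t) measurable_id.aestronglyMeasurable, h.mean_zero]
      simp [hkl]

theorem isNoiseLaw_gaussianReal {s : ℝ} (hs : 0 ≤ s) :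
    IsNoiseLaw (gaussianReal 0 s.toNNReal) (√s) := by
  refine ⟨inferInstance, memLp_id_gaussianReal 2, integral_id_gaussianReal, ?_⟩
  have h := variance_fun_id_gaussianReal (μ := 0) (v := s.toNNReal)
  rw [variance_of_integral_eq_zero (by fun_prop) integral_id_gaussianReal] at h
  rw [h, Real.sq_sqrt hs, Real.coe_toNNReal _ hs]

theorem isIsotropicInputLaw_isoGaussian (d : ℕ) {s : ℝ} (hs : 0 ≤ s) :
    IsIsotropicInputLaw (isoGaussian d s) s := by
  have := (isNoiseLaw_gaussianReal hs).pi d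
  rwa [Real.sq_sqrt hs] at this

section Isotropic

variable {d : ℕ} {μ : Measure (Fin d → ℝ)} {c : ℝ}

theorem IsIsotropicInputLaw.integrable_coord (h : IsIsotropicInputLaw μ c) (i : Fin d) :
    Integrable (fun x : Fin d → ℝ => x i) μ :=
  have := h.isProbabilityMeasure
  (h.memLp i).integrable one_le_two

theorem IsIsotropicInputLaw.memLp_dotProduct (h : IsIsotropicInputLaw μ c) (u : Fin d → ℝ) :
    MemLp (fun x => u ⬝ᵥ x) 2 μ :=
  memLp_finsetSum _ fun i _ => (h.memLp i).const_mul (u i)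

theorem IsIsotropicInputLaw.integral_dotProduct (h : IsIsotropicInputLaw μ c) (u : Fin d → ℝ) :
    ∫ x, u ⬝ᵥ x ∂μ = 0 := by
  simp only [dotProduct]
  rw [integral_finsetSum _ fun i _ => (h.integrable_coord i).const_mul _]
  simp [integral_const_mul, h.mean_zero]

theorem IsIsotropicInputLaw.integral_dotProduct_sq (h : IsIsotropicInputLaw μ c)
    (u : Fin d → ℝ) : ∫ x, (u ⬝ᵥ x) ^ 2 ∂μ = c * (u ⬝ᵥ u) := by
  have e : ∀ x : Fin d → ℝ, (u ⬝ᵥ x) ^ 2 = ∑ i, ∑ j, (u i * u j) * (x i * x j) := by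
    intro x
    simp only [dotProduct, sq, Finset.sum_mul_sum]
    exact Finset.sum_congr rfl fun i _ => Finset.sum_congr rfl fun j _ => by ring
  have hi : ∀ i j, Integrable (fun x : Fin d → ℝ => (u i * u j) * (x i * x j)) μ := fun i j =>
    ((h.memLp i).integrable_mul (h.memLp j)).const_mul _
  simp only [e]
  rw [integral_finsetSum _ fun i _ => integrable_finsetSum _ fun j _ => hi i j]
  simp only [integral_finsetSum _ fun j _ => hi _ j, integral_const_mul, h.covariance_eq,
    Matrix.smul_apply, Matrix.one_apply, smul_eq_mul, mul_ite, mul_one, mul_zero,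
    Finset.sum_ite_eq, Finset.mem_univ, if_true, dotProduct, Finset.mul_sum]
  exact Finset.sum_congr rfl fun i _ => by ring

theorem IsIsotropicInputLaw.integrable_add_sq (h : IsIsotropicInputLaw μ c) (u : Fin d → ℝ)
    (t : ℝ) : Integrable (fun x => (u ⬝ᵥ x + t) ^ 2) μ :=
  have := h.isProbabilityMeasure
  ((h.memLp_dotProduct u).add (memLp_const t)).integrable_sq

/-- The second moment of a linear functional of an isotropic vector plus a constant: the cross
term vanishes. -/
theorem IsIsotropicInputLaw.integral_add_sq (h : IsIsotropicInputLaw μ c) (u : Fin d → ℝ)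
    (t : ℝ) : ∫ x, (u ⬝ᵥ x + t) ^ 2 ∂μ = c * (u ⬝ᵥ u) + t ^ 2 := by
  have := h.isProbabilityMeasure
  have e : ∀ x, (u ⬝ᵥ x + t) ^ 2 = (u ⬝ᵥ x) ^ 2 + (2 * t * (u ⬝ᵥ x) + t ^ 2) := fun x => by ring
  have h1 := (h.memLp_dotProduct u).integrable one_le_two
  have h2 : Integrable (fun x => 2 * t * (u ⬝ᵥ x) + t ^ 2) μ :=
    (h1.const_mul _).add (integrable_const _)
  simp only [e]
  rw [integral_add (h.memLp_dotProduct u).integrable_sq h2,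
    integral_add (h1.const_mul _) (integrable_const _), integral_const_mul,
    h.integral_dotProduct, h.integral_dotProduct_sq]
  simp

/-- Vector form of `IsIsotropicInputLaw.integral_add_sq`. -/
theorem IsIsotropicInputLaw.lintegral_mulVec_add {p : ℕ} (h : IsIsotropicInputLaw μ c)
    (T : Matrix (Fin p) (Fin d) ℝ) (w : Fin p → ℝ) {a b : ℝ} (ha : 0 ≤ a) (hb : 0 ≤ b) :
    ∫⁻ x, ENNReal.ofReal (a * ((T *ᵥ x + w) ⬝ᵥ (T *ᵥ x + w)) + b) ∂μ
      = ENNReal.ofReal (a * (c * (T * Tᵀ).trace + w ⬝ᵥ w) + b) := by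
  have := h.isProbabilityMeasure
  have e : ∀ x, (T *ᵥ x + w) ⬝ᵥ (T *ᵥ x + w) = ∑ i, (T.row i ⬝ᵥ x + w i) ^ 2 := fun x => by
    simp [dotProduct, Matrix.mulVec, sq]
  have hi := fun i => h.integrable_add_sq (T.row i) (w i)
  have hs : Integrable (fun x => ∑ i, (T.row i ⬝ᵥ x + w i) ^ 2) μ :=
    integrable_finsetSum _ fun i _ => hi i
  have hab : Integrable (fun x => a * ∑ i, (T.row i ⬝ᵥ x + w i) ^ 2 + b) μ :=
    (hs.const_mul a).add (integrable_const b)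
  simp only [e]
  rw [← ofReal_integral_eq_lintegral_ofReal hab (Filter.Eventually.of_forall fun x => by
      have := Finset.sum_nonneg fun i (_ : i ∈ Finset.univ) => sq_nonneg (T.row i ⬝ᵥ x + w i)
      positivity),
    integral_add (hs.const_mul a) (integrable_const b),
    integral_const_mul, integral_finsetSum _ fun i _ => hi i]
  simp only [h.integral_add_sq, Finset.sum_add_distrib, ← Finset.mul_sum]
  have h1 : ∑ i, T.row i ⬝ᵥ T.row i = (T * Tᵀ).trace := by
    simp [Matrix.trace, Matrix.mul_apply, dotProduct]
  have h2 : ∑ i, w i ^ 2 = w ⬝ᵥ w := by simp [dotProduct, sq]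
  rw [h1, h2]
  simp

end Isotropic

/-! ### Centred ridge regression and its test error -/

/-- The resolvent `(Xᵀ X + t I)⁻¹`. -/
noncomputable def ridgeResolvent {d n : ℕ} (t : ℝ) (X : Matrix (Fin n) (Fin d) ℝ) :
    Matrix (Fin d) (Fin d) ℝ :=
  (Xᵀ * X + t • (1 : Matrix (Fin d) (Fin d) ℝ))⁻¹

/-- Ridge regression with penalty `t` shrinking towards the vector `g`. -/
noncomputable def centeredRidge {d n : ℕ} (t : ℝ) (X : Matrix (Fin n) (Fin d) ℝ) (y : Fin n → ℝ)
    (g : Fin d → ℝ) : Fin d → ℝ :=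
  ridgeResolvent t X *ᵥ (Xᵀ *ᵥ y + t • g)

theorem posDef_gram_add {d n : ℕ} {t : ℝ} (ht : 0 < t) (X : Matrix (Fin n) (Fin d) ℝ) :
    (Xᵀ * X + t • (1 : Matrix (Fin d) (Fin d) ℝ)).PosDef := by
  refine Matrix.PosDef.posSemidef_add ?_ (Matrix.PosDef.one.smul ht)
  simpa using Matrix.posSemidef_conjTranspose_mul_self X

theorem ridgeResolvent_mul {d n : ℕ} {t : ℝ} (ht : 0 < t) (X : Matrix (Fin n) (Fin d) ℝ) :
    ridgeResolvent t X * (Xᵀ * X + t • (1 : Matrix (Fin d) (Fin d) ℝ)) = 1 :=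
  Matrix.nonsing_inv_mul _ ((Matrix.isUnit_iff_isUnit_det _).1 (posDef_gram_add ht X).isUnit)

/-- Since the relation matrices are orthogonal, transfer learning is ridge regression centred at
the average of the pulled back source estimates. -/
theorem transferEstimator_eq_centeredRidge {d m n : ℕ} (hm : 0 < m) (α : ℝ)
    (H : Fin m → Matrix (Fin d) (Fin d) ℝ) (hH : ∀ j, (H j)ᵀ * H j = 1)
    (X : Matrix (Fin n) (Fin d) ℝ) (y : Fin n → ℝ) (θ : Fin m → Fin d → ℝ) :
    transferEstimator α H X y θ
      = centeredRidge (n * α * m) X y ((m : ℝ)⁻¹ • ∑ j, (H j)ᵀ *ᵥ θ j) := by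
  have hm' : (m : ℝ) ≠ 0 := by positivity
  simp only [transferEstimator, centeredRidge, ridgeResolvent, hH, Finset.sum_const,
    Finset.card_univ, Fintype.card_fin, smul_smul, mul_assoc, mul_inv_cancel₀ hm', mul_one,
    ← Nat.cast_smul_eq_nsmul ℝ]

theorem ridgeEstimator_eq_centeredRidge {d n : ℕ} (α : ℝ) (X : Matrix (Fin n) (Fin d) ℝ)
    (y : Fin n → ℝ) : ridgeEstimator α X y = centeredRidge (n * α) X y 0 := by
  simp [ridgeEstimator, centeredRidge, ridgeResolvent]

/-- The estimation error splits into a noise term and the shrunken error `g - β` of the centre. -/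
theorem centeredRidge_sub {d n : ℕ} {t : ℝ} (ht : 0 < t) (X : Matrix (Fin n) (Fin d) ℝ)
    (β g : Fin d → ℝ) (e : Fin n → ℝ) :
    centeredRidge t X (X *ᵥ β + e) g - β
      = (ridgeResolvent t X * Xᵀ) *ᵥ e + t • (ridgeResolvent t X *ᵥ (g - β)) := by
  have h : β = ridgeResolvent t X *ᵥ (Xᵀ *ᵥ (X *ᵥ β) + t • β) := by
    conv_lhs => rw [← Matrix.one_mulVec β, ← ridgeResolvent_mul ht X, ← Matrix.mulVec_mulVec,
      Matrix.add_mulVec, Matrix.smul_mulVec, Matrix.one_mulVec, ← Matrix.mulVec_mulVec]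
  ext i
  have hi := congrFun h i
  simp only [centeredRidge, Matrix.mulVec_add, Matrix.mulVec_sub, Matrix.mulVec_smul, smul_sub,
    Matrix.mulVec_mulVec, Pi.add_apply, Pi.sub_apply] at hi ⊢
  linarith

/-- A Bochner integral as a Lebesgue integral. -/
theorem lintegral_ofReal_eq {Ω : Type*} [MeasurableSpace Ω] {P : Measure Ω} {f : Ω → ℝ} {r : ℝ}
    (hf : Integrable f P) (h0 : ∀ w, 0 ≤ f w) (hr : ∫ w, f w ∂P = r) :
    ∫⁻ w, ENNReal.ofReal (f w) ∂P = ENNReal.ofReal r := by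
  rw [← hr, ofReal_integral_eq_lintegral_ofReal hf (Filter.Eventually.of_forall h0)]

theorem measurable_ridgeResolvent_entry {Ω : Type*} [MeasurableSpace Ω] {d n : ℕ} (t : ℝ)
    {F : Ω → Matrix (Fin n) (Fin d) ℝ} (hF : ∀ i j, Measurable fun w => F w i j) (i j : Fin d) :
    Measurable fun w => ridgeResolvent t (F w) i j := by
  refine measurable_inv_entry (fun a b => ?_) i j
  simp only [Matrix.add_apply]
  exact (measurable_mul_entry (fun a b => hF b a) hF a b).add_const _

/-- The squared prediction error at an independent test pair, for an estimation error `v`. -/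
theorem lintegral_test_sq {d : ℕ} {μx : Measure (Fin d → ℝ)} {c : ℝ}
    (hμx : IsIsotropicInputLaw μx c) {με : Measure ℝ} {σ : ℝ} (hμε : IsNoiseLaw με σ)
    (v : Fin d → ℝ) :
    ∫⁻ z, ENNReal.ofReal ((z.1 ⬝ᵥ v - z.2) ^ 2) ∂(μx.prod με)
      = ENNReal.ofReal (c * (v ⬝ᵥ v) + σ ^ 2) := by
  have := hμx.isProbabilityMeasure
  have := hμε.isProbabilityMeasure
  have hid : Integrable (fun e : ℝ => e) με := hμε.memLp.integrable one_le_two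
  have hsq : Integrable (fun e : ℝ => e ^ 2) με := hμε.memLp.integrable_sq
  have h1 : ∀ s : ℝ, ∫⁻ e, ENNReal.ofReal ((s - e) ^ 2) ∂με = ENNReal.ofReal (s ^ 2 + σ ^ 2) := by
    intro s
    have e1 : ∀ e : ℝ, (s - e) ^ 2 = e ^ 2 + ((-2 * s) * e + s ^ 2) := fun e => by ring
    have h2 : Integrable (fun e : ℝ => (-2 * s) * e + s ^ 2) με :=
      (hid.const_mul _).add (integrable_const _)
    refine lintegral_ofReal_eq (((hsq.add h2).congr (Filter.Eventually.of_forall fun e => ?_)))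
      (fun e => sq_nonneg _) ?_
    · exact (e1 e).symm
    · simp only [e1]
      rw [integral_add hsq h2, integral_add (hid.const_mul _) (integrable_const _),
        integral_const_mul, hμε.mean_zero, hμε.variance_eq]
      simp [add_comm]
  have hm : Measurable fun z : (Fin d → ℝ) × ℝ => ENNReal.ofReal ((z.1 ⬝ᵥ v - z.2) ^ 2) := by
    refine ENNReal.measurable_ofReal.comp (Measurable.pow_const (Measurable.sub ?_ ?_) 2)
    · exact measurable_dotProduct (fun i => by fun_prop) fun i => measurable_const
    · fun_prop
  rw [lintegral_prod _ hm.aemeasurable]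
  simp only [h1]
  have h3 := hμx.integrable_add_sq v 0
  simp only [add_zero] at h3
  have h4 : ∀ x : Fin d → ℝ, x ⬝ᵥ v = v ⬝ᵥ x := fun x => dotProduct_comm _ _
  simp only [h4]
  have h5 : Integrable (fun x => (v ⬝ᵥ x) ^ 2 + σ ^ 2) μx := h3.add (integrable_const _)
  refine lintegral_ofReal_eq h5 (fun x => by positivity) ?_
  rw [integral_add h3 (integrable_const _), hμx.integral_dotProduct_sq]
  simp

/-- Tonelli's theorem in the order in which the random elements are integrated out: test pair,
target noise, target parameter and sources, target inputs. -/
theorem lintegral_prod_reorder {Ω₁ Ω₂ Ω₃ Ω₄ Ω₅ : Type*} [MeasurableSpace Ω₁] [MeasurableSpace Ω₂]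
    [MeasurableSpace Ω₃] [MeasurableSpace Ω₄] [MeasurableSpace Ω₅] (P₁ : Measure Ω₁)
    (P₂ : Measure Ω₂) (P₃ : Measure Ω₃) (P₄ : Measure Ω₄) (P₅ : Measure Ω₅) [SFinite P₁]
    [SFinite P₂] [SFinite P₃] [SFinite P₄] [SFinite P₅]
    {F : Ω₁ × Ω₂ × (Ω₃ × Ω₄) × Ω₅ → ℝ≥0∞} (hF : Measurable F) :
    ∫⁻ w, F w ∂(P₁.prod (P₂.prod ((P₃.prod P₄).prod P₅)))
      = ∫⁻ x, ∫⁻ w, ∫⁻ e, ∫⁻ z, F (w.1, w.2, (x, e), z) ∂P₅ ∂P₄ ∂(P₁.prod P₂) ∂P₃ := by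
  have hG : Measurable fun w : (Ω₁ × Ω₂) × Ω₃ =>
      ∫⁻ e, ∫⁻ z, F (w.1.1, w.1.2, (w.2, e), z) ∂P₅ ∂P₄ := by
    have h1 : Measurable fun w : (((Ω₁ × Ω₂) × Ω₃) × Ω₄) × Ω₅ =>
        F (w.1.1.1.1, w.1.1.1.2, (w.1.1.2, w.1.2), w.2) := hF.comp (by fun_prop)
    exact (h1.lintegral_prod_right' (ν := P₅)).lintegral_prod_right' (ν := P₄)
  rw [← lintegral_lintegral_swap (μ := P₁.prod P₂)
    (f := fun w x => ∫⁻ e, ∫⁻ z, F (w.1, w.2, (x, e), z) ∂P₅ ∂P₄) hG.aemeasurable,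
    lintegral_prod _ hF.aemeasurable, lintegral_prod _ (hG.lintegral_prod_right').aemeasurable]
  refine lintegral_congr fun a => ?_
  have h1 : Measurable fun y : Ω₂ × (Ω₃ × Ω₄) × Ω₅ => F (a, y) := hF.comp (by fun_prop)
  rw [lintegral_prod _ h1.aemeasurable]
  refine lintegral_congr fun b => ?_
  have h2 : Measurable fun y : (Ω₃ × Ω₄) × Ω₅ => F (a, b, y) := hF.comp (by fun_prop)
  rw [lintegral_prod _ h2.aemeasurable, lintegral_prod _ (h2.lintegral_prod_right').aemeasurable]

/-- The expected test error of centred ridge regression, with the test pair and the training noise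
integrated out, and the training inputs moved to the outermost integral. -/
theorem lintegral_testLoss_centeredRidge {d m n k : ℕ} {t : ℝ} (ht : 0 < t) {c : ℝ} (hc : 0 ≤ c)
    {ν : Measure (Fin d → ℝ)} [IsProbabilityMeasure ν]
    {S : Measure (Fin m → SourceSample d k)} [IsProbabilityMeasure S]
    {μx : Measure (Fin d → ℝ)} (hμx : IsIsotropicInputLaw μx c)
    {με : Measure ℝ} {σ : ℝ} (hμε : IsNoiseLaw με σ)
    (g : (Fin d → ℝ) × (Fin m → SourceSample d k) → Fin d → ℝ)
    (hg : ∀ i, Measurable fun w => g w i) :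
    ∫⁻ w : Sample d m n k, ENNReal.ofReal
        (w.testLoss (centeredRidge t w.trainX w.trainY (g (w.1, w.2.1))))
        ∂(ν.prod (S.prod (((Measure.pi fun _ : Fin n => μx).prod
          (Measure.pi fun _ : Fin n => με)).prod (μx.prod με))))
      = ∫⁻ X, ∫⁻ w, ENNReal.ofReal (c * (σ ^ 2 * (ridgeResolvent t (Matrix.of X) * (Matrix.of X)ᵀ *
          (ridgeResolvent t (Matrix.of X) * (Matrix.of X)ᵀ)ᵀ).trace +
          (t • (ridgeResolvent t (Matrix.of X) *ᵥ (g w - w.1))) ⬝ᵥ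
            (t • (ridgeResolvent t (Matrix.of X) *ᵥ (g w - w.1)))) + σ ^ 2)
          ∂(ν.prod S) ∂(Measure.pi fun _ : Fin n => μx) := by
  have := hμx.isProbabilityMeasure
  have := hμε.isProbabilityMeasure
  -- the estimation error
  set D : (Fin d → ℝ) → (Fin m → SourceSample d k) → TargetSample d n → Fin d → ℝ :=
    fun β s T => (ridgeResolvent t (Matrix.of T.1) * (Matrix.of T.1)ᵀ) *ᵥ T.2
      + t • (ridgeResolvent t (Matrix.of T.1) *ᵥ (g (β, s) - β)) with hD
  have hloss : ∀ w : Sample d m n k,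
      w.testLoss (centeredRidge t w.trainX w.trainY (g (w.1, w.2.1)))
        = (w.2.2.2.1 ⬝ᵥ D w.1 w.2.1 w.2.2.1 - w.2.2.2.2) ^ 2 := by
    intro w
    have := centeredRidge_sub ht w.trainX w.1 (g (w.1, w.2.1)) w.2.2.1.2
    rw [Sample.testLoss, Sample.trainY, ← sub_sub, ← dotProduct_sub, this]
    rfl
  have hX : ∀ i j, Measurable fun w : Sample d m n k => Matrix.of w.2.2.1.1 i j := fun i j => by
    simp only [Matrix.of_apply]; fun_prop
  have hR := measurable_ridgeResolvent_entry t hX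
  have hDm : ∀ i, Measurable fun w : Sample d m n k => D w.1 w.2.1 w.2.2.1 i := by
    intro i
    simp only [hD, Pi.add_apply, Pi.smul_apply]
    refine Measurable.add ?_ (Measurable.const_smul ?_ t)
    · exact measurable_mulVec_entry (measurable_mul_entry hR fun a b => hX b a)
        (fun a => by fun_prop) i
    · refine measurable_mulVec_entry hR (fun a => ?_) i
      simp only [Pi.sub_apply]
      exact ((hg a).comp (by fun_prop)).sub (by fun_prop)
  have hF : Measurable fun w : Sample d m n k =>
      ENNReal.ofReal ((w.2.2.2.1 ⬝ᵥ D w.1 w.2.1 w.2.2.1 - w.2.2.2.2) ^ 2) := by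
    refine ENNReal.measurable_ofReal.comp (Measurable.pow_const (Measurable.sub ?_ ?_) 2)
    · exact measurable_dotProduct (fun i => by fun_prop) hDm
    · fun_prop
  refine (lintegral_congr fun w => congrArg ENNReal.ofReal (hloss w)).trans ?_
  refine (lintegral_prod_reorder _ _ _ _ _ hF).trans ?_
  refine lintegral_congr fun X => ?_
  refine lintegral_congr fun w => ?_
  refine (lintegral_congr fun e => lintegral_test_sq hμx hμε (D w.1 w.2 (X, e))).trans ?_
  exact (hμε.pi n).lintegral_mulVec_add (ridgeResolvent t (Matrix.of X) * (Matrix.of X)ᵀ)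
    (t • (ridgeResolvent t (Matrix.of X) *ᵥ (g w - w.1))) hc (sq_nonneg σ)

/-! ### Moments of a single source estimate -/

/-- A nonnegative function with finite Lebesgue integral is integrable, and its Bochner integral is
bounded accordingly. -/
theorem integrable_and_integral_le {Ω : Type*} [MeasurableSpace Ω] {P : Measure Ω} {f : Ω → ℝ}
    {r : ℝ} (hr : 0 ≤ r) (hf : Measurable f) (h0 : ∀ w, 0 ≤ f w)
    (h : ∫⁻ w, ENNReal.ofReal (f w) ∂P ≤ ENNReal.ofReal r) :
    Integrable f P ∧ ∫ w, f w ∂P ≤ r := by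
  have hi : Integrable f P := ⟨hf.aestronglyMeasurable, by
    rw [hasFiniteIntegral_iff_ofReal (Filter.Eventually.of_forall h0)]
    exact h.trans_lt ENNReal.ofReal_lt_top⟩
  refine ⟨hi, ?_⟩
  rwa [← ENNReal.ofReal_le_ofReal_iff hr,
    ofReal_integral_eq_lintegral_ofReal hi (Filter.Eventually.of_forall h0)]

/-- The second moment of a sum of independent variables: the sum of the variances plus the square
of the mean. -/
theorem integral_pi_sum_sq {ι : Type*} [Fintype ι] {Ω : ι → Type*} [∀ i, MeasurableSpace (Ω i)]
    {μ : ∀ i, Measure (Ω i)} [∀ i, IsProbabilityMeasure (μ i)] {X : ∀ i, Ω i → ℝ}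
    (h : ∀ i, MemLp (X i) 2 (μ i)) :
    Integrable (fun w => (∑ i, X i (w i)) ^ 2) (Measure.pi μ) ∧
      ∫ w, (∑ i, X i (w i)) ^ 2 ∂Measure.pi μ
        = ∑ i, (∫ t, X i t ^ 2 ∂μ i - (∫ t, X i t ∂μ i) ^ 2) + (∑ i, ∫ t, X i t ∂μ i) ^ 2 := by
  have hi : ∀ i, MemLp (fun w : ∀ i, Ω i => X i (w i)) 2 (Measure.pi μ) := fun i =>
    (h i).comp_measurePreserving (measurePreserving_eval μ i)
  have hs : MemLp (fun w : ∀ i, Ω i => ∑ i, X i (w i)) 2 (Measure.pi μ) :=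
    memLp_finsetSum _ fun i _ => hi i
  refine ⟨hs.integrable_sq, ?_⟩
  have h1 := variance_sum_pi h
  have e : (∑ i, fun w : ∀ i, Ω i => X i (w i)) = fun w => ∑ i, X i (w i) := by
    ext w; simp
  have hmean : ∫ w, ∑ i, X i (w i) ∂Measure.pi μ = ∑ i, ∫ t, X i t ∂μ i := by
    rw [integral_finsetSum _ fun i _ => (hi i).integrable one_le_two]
    refine Finset.sum_congr rfl fun i _ => ?_
    have hmp := measurePreserving_eval μ i
    have := integral_map hmp.measurable.aemeasurable (f := X i)
      (by rw [hmp.map_eq]; exact (h i).aestronglyMeasurable)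
    rw [hmp.map_eq] at this
    exact this.symm
  rw [e, variance_eq_sub hs, hmean] at h1
  simp only [variance_eq_sub (h _)] at h1
  simp only [Pi.pow_apply] at h1
  linarith

section Source

variable {d k : ℕ}

/-- The part of a source estimate, tested against a vector, that is due to the task noise and to
the label noise. -/
noncomputable def sourceNoise (h : Fin d → ℝ) (s : SourceSample d k) : ℝ :=
  (rowProj (Matrix.of s.2.1) *ᵥ h) ⬝ᵥ s.1 + ((pinv (Matrix.of s.2.1))ᵀ *ᵥ h) ⬝ᵥ s.2.2

theorem measurable_sourceNoise (h : Fin d → ℝ) :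
    Measurable (sourceNoise h : SourceSample d k → ℝ) := by
  have hZ : ∀ i j, Measurable fun s : SourceSample d k => Matrix.of s.2.1 i j := fun i j => by
    simp only [Matrix.of_apply]; fun_prop
  refine (measurable_dotProduct ?_ fun i => by fun_prop).add
    (measurable_dotProduct ?_ fun i => by fun_prop)
  · exact measurable_mulVec_entry (measurable_rowProj_entry hZ) fun _ => measurable_const
  · exact measurable_mulVec_entry (F := fun s : SourceSample d k => (pinv (Matrix.of s.2.1))ᵀ)
      (fun i j => measurable_pinv_entry hZ j i) fun _ => measurable_const

variable {ση σξ : ℝ} {μξ : Measure ℝ}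

theorem isProbabilityMeasure_sourceLaw (hξ : IsNoiseLaw μξ σξ) :
    IsProbabilityMeasure (sourceLaw d k ση μξ) := by
  have := hξ.isProbabilityMeasure
  unfold sourceLaw
  infer_instance

theorem sourceLaw_eq : sourceLaw d k ση μξ = (isoGaussian d (ση ^ 2 / d)).prod
    ((gaussianRows k d).prod (Measure.pi fun _ : Fin k => μξ)) := rfl

theorem measurePreserving_sourceInputs (hξ : IsNoiseLaw μξ σξ) :
    MeasurePreserving (fun s : SourceSample d k => s.2.1) (sourceLaw d k ση μξ)
      (gaussianRows k d) := by
  have := hξ.isProbabilityMeasure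
  rw [sourceLaw_eq]
  exact measurePreserving_fst.comp measurePreserving_snd

/-- The noises are integrated out first, given the source inputs. -/
theorem sourceNoise_sq_moment (hd : 0 < d) (h₁ : d + 1 ≠ k) (h₂ : d ≠ k) (h₃ : d ≠ k + 1)
    (hξ : IsNoiseLaw μξ σξ) (h : Fin d → ℝ) :
    Integrable (fun s => sourceNoise h s ^ 2) (sourceLaw d k ση μξ) ∧
      ∫ s, sourceNoise h s ^ 2 ∂sourceLaw d k ση μξ
        ≤ (ση ^ 2 / d * overparamFactor d k
          + σξ ^ 2 * (overparamFactor d k / (|(d : ℝ) - k| - 1))) * (h ⬝ᵥ h) := by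
  have := hξ.isProbabilityMeasure
  have hs : 0 ≤ ση ^ 2 / d := by positivity
  have hρ0 : 0 ≤ overparamFactor d k := by unfold overparamFactor; split_ifs <;> positivity
  have h4 := one_le_abs_sub_sub_one h₁ h₂ h₃
  have hη := isIsotropicInputLaw_isoGaussian d hs
  have hξk := hξ.pi k
  have hi1 := integrable_rowProj_dotProduct (k := k) h
  have hi2 := integrable_pinv_transpose_dotProduct hd h₁ h₂ h₃ h
  have hm : Measurable fun s : SourceSample d k => sourceNoise h s ^ 2 :=
    (measurable_sourceNoise h).pow_const 2
  have hh := dotProduct_self_nonneg_real h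
  refine integrable_and_integral_le (by positivity) hm (fun _ => sq_nonneg _) ?_
  have hin1 : ∀ y : (Fin k → Fin d → ℝ) × (Fin k → ℝ),
      ∫⁻ e, ENNReal.ofReal (sourceNoise h (e, y) ^ 2) ∂isoGaussian d (ση ^ 2 / d)
      = ENNReal.ofReal (ση ^ 2 / d * ((rowProj (Matrix.of y.1) *ᵥ h) ⬝ᵥ
          (rowProj (Matrix.of y.1) *ᵥ h)) + (((pinv (Matrix.of y.1))ᵀ *ᵥ h) ⬝ᵥ y.2) ^ 2) := fun y =>
    lintegral_ofReal_eq
      (hη.integrable_add_sq (rowProj (Matrix.of y.1) *ᵥ h) (((pinv (Matrix.of y.1))ᵀ *ᵥ h) ⬝ᵥ y.2))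
      (fun _ => sq_nonneg _)
      (hη.integral_add_sq (rowProj (Matrix.of y.1) *ᵥ h) (((pinv (Matrix.of y.1))ᵀ *ᵥ h) ⬝ᵥ y.2))
  have hin2 : ∀ Z : Fin k → Fin d → ℝ,
      ∫⁻ x, ENNReal.ofReal (ση ^ 2 / d * ((rowProj (Matrix.of Z) *ᵥ h) ⬝ᵥ
          (rowProj (Matrix.of Z) *ᵥ h)) + (((pinv (Matrix.of Z))ᵀ *ᵥ h) ⬝ᵥ x) ^ 2)
          ∂(Measure.pi fun _ : Fin k => μξ)
      = ENNReal.ofReal (ση ^ 2 / d * ((rowProj (Matrix.of Z) *ᵥ h) ⬝ᵥ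
          (rowProj (Matrix.of Z) *ᵥ h)) + σξ ^ 2 * (((pinv (Matrix.of Z))ᵀ *ᵥ h) ⬝ᵥ
            ((pinv (Matrix.of Z))ᵀ *ᵥ h))) := by
    intro Z
    have h5 := (hξk.memLp_dotProduct ((pinv (Matrix.of Z))ᵀ *ᵥ h)).integrable_sq
    have h6 := dotProduct_self_nonneg_real (rowProj (Matrix.of Z) *ᵥ h)
    refine lintegral_ofReal_eq ((integrable_const _).add h5)
      (fun _ => by positivity) ?_
    rw [integral_add (integrable_const _) h5, hξk.integral_dotProduct_sq]
    simp
  have hm1 := (ENNReal.measurable_ofReal.comp hm).lintegral_prod_left'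
    (μ := isoGaussian d (ση ^ 2 / d))
  have hm2 : Measurable fun y : (Fin k → Fin d → ℝ) × (Fin k → ℝ) =>
      ENNReal.ofReal (ση ^ 2 / d * ((rowProj (Matrix.of y.1) *ᵥ h) ⬝ᵥ
        (rowProj (Matrix.of y.1) *ᵥ h)) + (((pinv (Matrix.of y.1))ᵀ *ᵥ h) ⬝ᵥ y.2) ^ 2) := by
    convert! hm1 using 1
    exact funext fun y => (hin1 y).symm
  have hi3 : Integrable (fun Z : Fin k → Fin d → ℝ =>
      ση ^ 2 / d * ((rowProj (Matrix.of Z) *ᵥ h) ⬝ᵥ (rowProj (Matrix.of Z) *ᵥ h))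
        + σξ ^ 2 * (((pinv (Matrix.of Z))ᵀ *ᵥ h) ⬝ᵥ ((pinv (Matrix.of Z))ᵀ *ᵥ h)))
      (gaussianRows k d) := (hi1.const_mul _).add (hi2.const_mul _)
  have hval : ∫ Z : Fin k → Fin d → ℝ,
      ση ^ 2 / d * ((rowProj (Matrix.of Z) *ᵥ h) ⬝ᵥ (rowProj (Matrix.of Z) *ᵥ h))
        + σξ ^ 2 * (((pinv (Matrix.of Z))ᵀ *ᵥ h) ⬝ᵥ ((pinv (Matrix.of Z))ᵀ *ᵥ h)) ∂gaussianRows k d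
      ≤ (ση ^ 2 / d * overparamFactor d k
          + σξ ^ 2 * (overparamFactor d k / (|(d : ℝ) - k| - 1))) * (h ⬝ᵥ h) := by
    rw [integral_add (hi1.const_mul _) (hi2.const_mul _), integral_const_mul, integral_const_mul,
      integral_rowProj_dotProduct_self hd]
    have := mul_le_mul_of_nonneg_left (integral_pinv_transpose_dotProduct_le hd h₁ h₂ h₃ h)
      (sq_nonneg σξ)
    linarith
  rw [sourceLaw_eq]
  refine (lintegral_prod_symm _ (ENNReal.measurable_ofReal.comp hm).aemeasurable).trans_le ?_
  refine (lintegral_congr hin1).trans_le ?_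
  refine (lintegral_prod _ hm2.aemeasurable).trans_le ?_
  refine (lintegral_congr hin2).trans_le ?_
  refine (lintegral_ofReal_eq hi3 (fun Z => ?_) rfl).trans_le (ENNReal.ofReal_le_ofReal hval)
  have h6 := dotProduct_self_nonneg_real (rowProj (Matrix.of Z) *ᵥ h)
  have h7 := dotProduct_self_nonneg_real ((pinv (Matrix.of Z))ᵀ *ᵥ h)
  positivity

theorem memLp_sourceNoise (hd : 0 < d) (h₁ : d + 1 ≠ k) (h₂ : d ≠ k) (h₃ : d ≠ k + 1)
    (hξ : IsNoiseLaw μξ σξ) (h : Fin d → ℝ) :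
    MemLp (sourceNoise h) 2 (sourceLaw d k ση μξ) :=
  (memLp_two_iff_integrable_sq (measurable_sourceNoise h).aestronglyMeasurable).2
    (sourceNoise_sq_moment hd h₁ h₂ h₃ hξ h).1

theorem integral_sourceNoise (hd : 0 < d) (h₁ : d + 1 ≠ k) (h₂ : d ≠ k) (h₃ : d ≠ k + 1)
    (hξ : IsNoiseLaw μξ σξ) (h : Fin d → ℝ) :
    ∫ s, sourceNoise h s ∂sourceLaw d k ση μξ = 0 := by
  have := hξ.isProbabilityMeasure
  have := isProbabilityMeasure_sourceLaw (d := d) (k := k) (ση := ση) hξ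
  have hη := isIsotropicInputLaw_isoGaussian d (s := ση ^ 2 / d) (by positivity)
  have hξk := hξ.pi k
  have hi := (memLp_sourceNoise (ση := ση) hd h₁ h₂ h₃ hξ h).integrable one_le_two
  rw [sourceLaw_eq] at hi ⊢
  have hin : ∀ y : (Fin k → Fin d → ℝ) × (Fin k → ℝ),
      ∫ e, sourceNoise h (e, y) ∂isoGaussian d (ση ^ 2 / d)
        = ((pinv (Matrix.of y.1))ᵀ *ᵥ h) ⬝ᵥ y.2 := by
    intro y
    simp only [sourceNoise]
    rw [integral_add ((hη.memLp_dotProduct _).integrable one_le_two) (integrable_const _),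
      hη.integral_dotProduct]
    simp
  have hi2 := hi.integral_prod_right
  rw [integral_prod_symm _ hi]
  simp only [hin] at hi2 ⊢
  rw [integral_prod _ hi2]
  simp only [hξk.integral_dotProduct, integral_zero]

/-- The part of the parameter missed by a source estimate, tested against a vector `a`:
`Hᵀ (I - Z⁺ Z) H a`. -/
noncomputable def sourceDefect (H : Matrix (Fin d) (Fin d) ℝ) (a : Fin d → ℝ)
    (s : SourceSample d k) : Fin d → ℝ :=
  Hᵀ *ᵥ (H *ᵥ a - rowProj (Matrix.of s.2.1) *ᵥ (H *ᵥ a))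

variable {H : Matrix (Fin d) (Fin d) ℝ}

theorem measurable_sourceDefect (H : Matrix (Fin d) (Fin d) ℝ) (a : Fin d → ℝ) (i : Fin d) :
    Measurable fun s : SourceSample d k => sourceDefect H a s i := by
  refine measurable_mulVec_entry (F := fun _ : SourceSample d k => Hᵀ)
    (fun _ _ => measurable_const) (fun j => ?_) i
  simp only [Pi.sub_apply]
  refine measurable_const.sub (measurable_mulVec_entry (measurable_rowProj_entry fun i j => ?_)
    (v := fun _ : SourceSample d k => H *ᵥ a) (fun _ => measurable_const) j)
  simp only [Matrix.of_apply]; fun_prop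

theorem sourceDefect_dotProduct_self (hH : Hᵀ * H = 1) (a : Fin d → ℝ) (s : SourceSample d k) :
    sourceDefect H a s ⬝ᵥ sourceDefect H a s = a ⬝ᵥ a -
      (rowProj (Matrix.of s.2.1) *ᵥ (H *ᵥ a)) ⬝ᵥ (rowProj (Matrix.of s.2.1) *ᵥ (H *ᵥ a)) := by
  have hH' : Hᵀᵀ * Hᵀ = 1 := by rw [Matrix.transpose_transpose, mul_eq_one_comm.1 hH]
  rw [sourceDefect, dotProduct_orthogonal hH', rowProj_pythagoras, dotProduct_orthogonal hH]

/-- The error of a source estimate, pulled back to the target: a linear functional of the target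
parameter plus noise. -/
theorem dotProduct_sourceEstimate (hH : Hᵀ * H = 1) (a β : Fin d → ℝ) (s : SourceSample d k) :
    a ⬝ᵥ (Hᵀ *ᵥ sourceEstimate H β s - β)
      = -(sourceDefect H a s ⬝ᵥ β) + sourceNoise (H *ᵥ a) s := by
  have e1 : sourceEstimate H β s = rowProj (Matrix.of s.2.1) *ᵥ (H *ᵥ β + s.1)
      + pinv (Matrix.of s.2.1) *ᵥ s.2.2 := by
    rw [sourceEstimate, Matrix.mulVec_add, Matrix.mulVec_mulVec, rowProj]
  have e2 : sourceDefect H a s ⬝ᵥ β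
      = a ⬝ᵥ β - (H *ᵥ a) ⬝ᵥ (rowProj (Matrix.of s.2.1) *ᵥ (H *ᵥ β)) := by
    rw [sourceDefect, mulVec_dotProduct_eq, Matrix.transpose_transpose, sub_dotProduct,
      dotProduct_orthogonal hH, mulVec_dotProduct_eq (rowProj _), rowProj_transpose]
  rw [e2, e1, sourceNoise, dotProduct_sub, ← mulVec_dotProduct_eq, Matrix.mulVec_add,
    dotProduct_add, dotProduct_add, mulVec_dotProduct_eq (rowProj _), rowProj_transpose,
    mulVec_dotProduct_eq (pinv _)ᵀ, Matrix.transpose_transpose]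
  ring

theorem memLp_sourceDefect (hξ : IsNoiseLaw μξ σξ) (hH : Hᵀ * H = 1) (a : Fin d → ℝ)
    (i : Fin d) : MemLp (fun s => sourceDefect H a s i) 2 (sourceLaw d k ση μξ) := by
  have := isProbabilityMeasure_sourceLaw (d := d) (k := k) (ση := ση) hξ
  refine MemLp.of_bound (measurable_sourceDefect H a i).aestronglyMeasurable (a ⬝ᵥ a + 1)
    (Filter.Eventually.of_forall fun s => ?_)
  have h1 := sourceDefect_dotProduct_self hH a s
  have h2 := Finset.single_le_sum (f := fun l => sourceDefect H a s l * sourceDefect H a s l)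
    (fun l _ => mul_self_nonneg _) (Finset.mem_univ i)
  change _ ≤ sourceDefect H a s ⬝ᵥ sourceDefect H a s at h2
  have h3 := dotProduct_self_nonneg_real (rowProj (Matrix.of s.2.1) *ᵥ (H *ᵥ a))
  rw [Real.norm_eq_abs]
  have h4 := abs_mul_abs_self (sourceDefect H a s i)
  nlinarith [sq_nonneg (|sourceDefect H a s i| - 1), abs_nonneg (sourceDefect H a s i)]

theorem integral_comp_sourceInputs (hξ : IsNoiseLaw μξ σξ) {f : (Fin k → Fin d → ℝ) → ℝ}
    (hf : Measurable f) :
    ∫ s, f s.2.1 ∂sourceLaw d k ση μξ = ∫ Z, f Z ∂gaussianRows k d := by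
  have hmp := measurePreserving_sourceInputs (d := d) (k := k) (ση := ση) hξ
  have := integral_map (μ := sourceLaw d k ση μξ) hmp.measurable.aemeasurable
    (f := f) hf.aestronglyMeasurable
  rw [hmp.map_eq] at this
  exact this.symm

theorem integral_sourceDefect (hd : 0 < d) (hξ : IsNoiseLaw μξ σξ) (hH : Hᵀ * H = 1)
    (a : Fin d → ℝ) (i : Fin d) :
    ∫ s, sourceDefect H a s i ∂sourceLaw d k ση μξ = (1 - overparamFactor d k) * a i := by
  have hm := measurable_sourceDefect (k := k) H a i
  have h1 := integral_comp_sourceInputs (d := d) (k := k) (ση := ση) hξ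
    (f := fun Z => sourceDefect H a (0, Z, 0) i) (hm.comp (by fun_prop))
  refine Eq.trans h1 ?_
  have h2 : ∀ Z : Fin k → Fin d → ℝ, sourceDefect H a (0, Z, (0 : Fin k → ℝ)) i
      = a i - ∑ l, H l i * (rowProj (Matrix.of Z) *ᵥ (H *ᵥ a)) l := by
    intro Z
    rw [sourceDefect, Matrix.mulVec_sub, Matrix.mulVec_mulVec, hH, Matrix.one_mulVec]
    rfl
  have hi : ∀ l, Integrable (fun Z : Fin k → Fin d → ℝ =>
      H l i * (rowProj (Matrix.of Z) *ᵥ (H *ᵥ a)) l) (gaussianRows k d) := fun l =>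
    (integrable_rowProj_mulVec _ l).const_mul _
  simp only [h2]
  rw [integral_sub (integrable_const _) (integrable_finsetSum _ fun l _ => hi l),
    integral_finsetSum _ fun l _ => hi l]
  simp only [integral_const_mul, integral_rowProj_mulVec hd]
  have h3 : ∑ l, H l i * (overparamFactor d k * (H *ᵥ a) l) = overparamFactor d k * a i := by
    have : (Hᵀ *ᵥ (H *ᵥ a)) i = a i := by rw [Matrix.mulVec_mulVec, hH, Matrix.one_mulVec]
    rw [← this]
    rw [show (Hᵀ *ᵥ (H *ᵥ a)) i = ∑ l, H l i * (H *ᵥ a) l from rfl, Finset.mul_sum]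
    exact Finset.sum_congr rfl fun l _ => by ring
  rw [h3]
  simp
  ring

theorem sum_integral_sourceDefect_sq (hd : 0 < d) (hξ : IsNoiseLaw μξ σξ) (hH : Hᵀ * H = 1)
    (a : Fin d → ℝ) :
    ∑ i, ∫ s, sourceDefect H a s i ^ 2 ∂sourceLaw d k ση μξ
      = (1 - overparamFactor d k) * (a ⬝ᵥ a) := by
  rw [← integral_finsetSum _ fun i _ => (memLp_sourceDefect hξ hH a i).integrable_sq]
  have h1 : ∀ s : SourceSample d k, ∑ i, sourceDefect H a s i ^ 2 = a ⬝ᵥ a -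
      (rowProj (Matrix.of s.2.1) *ᵥ (H *ᵥ a)) ⬝ᵥ (rowProj (Matrix.of s.2.1) *ᵥ (H *ᵥ a)) :=
    fun s => by
      rw [← sourceDefect_dotProduct_self hH]
      simp [dotProduct, sq]
  simp only [h1]
  have hm : Measurable fun Z : Fin k → Fin d → ℝ => a ⬝ᵥ a -
      (rowProj (Matrix.of Z) *ᵥ (H *ᵥ a)) ⬝ᵥ (rowProj (Matrix.of Z) *ᵥ (H *ᵥ a)) :=
    measurable_const.sub (measurable_rowProj_dotProduct (H *ᵥ a))
  refine (integral_comp_sourceInputs hξ hm).trans ?_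
  rw [integral_sub (integrable_const _) (integrable_rowProj_dotProduct _),
    integral_rowProj_dotProduct_self hd, dotProduct_orthogonal hH]
  simp
  ring

end Source

/-! ### The averaged source estimates -/

section Transfer

variable {d m k : ℕ} {b ση σξ : ℝ}

/-- The average of the source estimates, pulled back to the target by the task relations. -/
noncomputable def transferCenter (H : Fin m → Matrix (Fin d) (Fin d) ℝ)
    (w : (Fin d → ℝ) × (Fin m → SourceSample d k)) : Fin d → ℝ :=
  (m : ℝ)⁻¹ • ∑ j, (H j)ᵀ *ᵥ sourceEstimate (H j) w.1 (w.2 j)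

theorem measurable_transferCenter (H : Fin m → Matrix (Fin d) (Fin d) ℝ) (i : Fin d) :
    Measurable fun w : (Fin d → ℝ) × (Fin m → SourceSample d k) => transferCenter H w i := by
  simp only [transferCenter, Pi.smul_apply, Finset.sum_apply, smul_eq_mul]
  suffices key : ∀ j, Measurable fun w : (Fin d → ℝ) × (Fin m → SourceSample d k) =>
      ((H j)ᵀ *ᵥ sourceEstimate (H j) w.1 (w.2 j)) i from
    (Finset.measurable_sum _ fun j _ => key j).const_mul _
  intro j
  have hZ : ∀ a b, Measurable fun w : (Fin d → ℝ) × (Fin m → SourceSample d k) =>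
      Matrix.of (w.2 j).2.1 a b := fun a b => by
    simp only [Matrix.of_apply]; fun_prop
  have hβ : ∀ a, Measurable fun w : (Fin d → ℝ) × (Fin m → SourceSample d k) =>
      (H j *ᵥ w.1 + (w.2 j).1) a := fun a =>
    (measurable_mulVec_entry (F := fun _ : (Fin d → ℝ) × (Fin m → SourceSample d k) => H j)
      (v := fun w => w.1) (fun _ _ => measurable_const) (fun a => by fun_prop) a).add (by fun_prop)
  have hv : ∀ a, Measurable fun w : (Fin d → ℝ) × (Fin m → SourceSample d k) =>
      (Matrix.of (w.2 j).2.1 *ᵥ (H j *ᵥ w.1 + (w.2 j).1) + (w.2 j).2.2) a := fun a =>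
    (measurable_mulVec_entry hZ hβ a).add (by fun_prop)
  exact measurable_mulVec_entry (F := fun _ : (Fin d → ℝ) × (Fin m → SourceSample d k) => (H j)ᵀ)
    (fun _ _ => measurable_const)
    (fun a => measurable_mulVec_entry (measurable_pinv_entry hZ) hv a) i

/-- An upper bound for the variance per coordinate of the error of the averaged source estimates.
The first summand is the part of the target parameter that the projections onto the source row
spaces miss, the second is the noise of the sources. -/
noncomputable def transferVariance (d m k : ℕ) (b ση σξ : ℝ) : ℝ :=
  (b / d * (m * ((1 - overparamFactor d k) - (1 - overparamFactor d k) ^ 2)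
      + m ^ 2 * (1 - overparamFactor d k) ^ 2)
    + m * (ση ^ 2 / d * overparamFactor d k
      + σξ ^ 2 * (overparamFactor d k / (|(d : ℝ) - k| - 1)))) / m ^ 2

/-- The condition on the source noise says exactly that this bound for the averaged source estimates
is below the variance `b / d` of the zero vector as an estimate of the target parameter. -/
theorem transferVariance_lt (hd : 0 < d) (hm : 0 < m) (hk : 0 < k) (h₁ : d + 1 ≠ k) (h₂ : d ≠ k)
    (h₃ : d ≠ k + 1)
    (hcond : ση ^ 2 + d * σξ ^ 2 / (|(d : ℝ) - k| - 1)
      < b * (m + ((m : ℝ) - 1) * (1 - overparamFactor d k))) :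
    transferVariance d m k b ση σξ < b / d := by
  have hρ := overparamFactor_pos hd hk
  have h4 := one_le_abs_sub_sub_one h₁ h₂ h₃
  have hd' : (0 : ℝ) < d := by positivity
  have hm' : (0 : ℝ) < m := by positivity
  set ρ := overparamFactor d k
  set D := |(d : ℝ) - k| - 1
  have hD : 0 < D := by linarith
  rw [transferVariance, div_lt_iff₀ (by positivity)]
  -- multiplied by `m ρ / d`, the condition becomes the claim, since
  -- `ρ (m + (m - 1) (1 - ρ)) = m - (1 - ρ) - (m - 1) (1 - ρ) ^ 2`
  have h5 := mul_lt_mul_of_pos_left hcond (show 0 < m * ρ / d by positivity)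
  have e1 : m * ρ / d * (ση ^ 2 + d * σξ ^ 2 / D)
      = m * (ση ^ 2 / d * ρ + σξ ^ 2 * (ρ / D)) := by
    field_simp
  rw [e1] at h5
  refine (add_lt_add_right h5 _).trans_eq ?_
  field_simp
  ring

/-- A linear functional of the error of the averaged source estimates is a linear functional of
the target parameter plus independent noise. -/
theorem dotProduct_transferCenter_sub (hm : 0 < m) {H : Fin m → Matrix (Fin d) (Fin d) ℝ}
    (hH : ∀ j, (H j)ᵀ * H j = 1) (a : Fin d → ℝ)
    (w : (Fin d → ℝ) × (Fin m → SourceSample d k)) :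
    a ⬝ᵥ (transferCenter H w - w.1) = (m : ℝ)⁻¹ *
      ((-∑ j, sourceDefect (H j) a (w.2 j)) ⬝ᵥ w.1
        + ∑ j, sourceNoise (H j *ᵥ a) (w.2 j)) := by
  have hm' : (m : ℝ) ≠ 0 := by positivity
  have h1 : transferCenter H w - w.1
      = (m : ℝ)⁻¹ • ∑ j, ((H j)ᵀ *ᵥ sourceEstimate (H j) w.1 (w.2 j) - w.1) := by
    rw [Finset.sum_sub_distrib, smul_sub, transferCenter]
    simp [← Nat.cast_smul_eq_nsmul ℝ, smul_smul, inv_mul_cancel₀ hm']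
  rw [h1, dotProduct_smul, dotProduct_sum, smul_eq_mul]
  simp only [dotProduct_sourceEstimate (hH _), Finset.sum_add_distrib, neg_dotProduct,
    sum_dotProduct, Finset.sum_neg_distrib]

variable {μξ : Fin m → Measure ℝ} {H : Fin m → Matrix (Fin d) (Fin d) ℝ}

/-- Each defect has second moment `(1 - ρ) ‖a‖ ^ 2` and mean `(1 - ρ) a`; the defects of different
sources are independent. -/
theorem sum_sourceDefect_moment (hd : 0 < d) (hξ : ∀ j, IsNoiseLaw (μξ j) σξ)
    (hH : ∀ j, (H j)ᵀ * H j = 1) (a : Fin d → ℝ) :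
    Integrable (fun s : Fin m → SourceSample d k => (-∑ j, sourceDefect (H j) a (s j)) ⬝ᵥ
        (-∑ j, sourceDefect (H j) a (s j))) (Measure.pi fun j => sourceLaw d k ση (μξ j)) ∧
      ∫ s, (-∑ j, sourceDefect (H j) a (s j)) ⬝ᵥ (-∑ j, sourceDefect (H j) a (s j))
        ∂(Measure.pi fun j => sourceLaw d k ση (μξ j))
      = (m * ((1 - overparamFactor d k) - (1 - overparamFactor d k) ^ 2)
          + m ^ 2 * (1 - overparamFactor d k) ^ 2) * (a ⬝ᵥ a) := by
  have := fun j => isProbabilityMeasure_sourceLaw (d := d) (k := k) (ση := ση) (hξ j)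
  have h1 := fun i => integral_pi_sum_sq (μ := fun j => sourceLaw d k ση (μξ j))
    (X := fun j s => sourceDefect (H j) a s i) fun j => memLp_sourceDefect (hξ j) (hH j) a i
  have e : ∀ s : Fin m → SourceSample d k, (-∑ j, sourceDefect (H j) a (s j)) ⬝ᵥ
      (-∑ j, sourceDefect (H j) a (s j)) = ∑ i, (∑ j, sourceDefect (H j) a (s j) i) ^ 2 := by
    intro s
    rw [neg_dotProduct_neg]
    simp [dotProduct, sq]
  simp only [e]
  refine ⟨integrable_finsetSum _ fun i _ => (h1 i).1, ?_⟩
  rw [integral_finsetSum _ fun i _ => (h1 i).1]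
  simp only [(h1 _).2, integral_sourceDefect hd (hξ _) (hH _)]
  rw [Finset.sum_add_distrib, Finset.sum_comm]
  simp only [Finset.sum_sub_distrib, sum_integral_sourceDefect_sq hd (hξ _) (hH _),
    Finset.sum_const, Finset.card_univ, Fintype.card_fin, nsmul_eq_mul]
  have h2 : ∀ q : ℝ, ∑ i, (q * a i) ^ 2 = q ^ 2 * (a ⬝ᵥ a) := fun q => by
    simp only [mul_pow, ← Finset.mul_sum, dotProduct, ← sq]
  simp only [← mul_assoc, h2]
  ring

/-- The noises of the sources are independent and centred, so their second moments add up. -/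
theorem sum_sourceNoise_moment (hd : 0 < d) (h₁ : d + 1 ≠ k) (h₂ : d ≠ k) (h₃ : d ≠ k + 1)
    (hξ : ∀ j, IsNoiseLaw (μξ j) σξ) (hH : ∀ j, (H j)ᵀ * H j = 1) (a : Fin d → ℝ) :
    Integrable (fun s : Fin m → SourceSample d k => (∑ j, sourceNoise (H j *ᵥ a) (s j)) ^ 2)
        (Measure.pi fun j => sourceLaw d k ση (μξ j)) ∧
      ∫ s, (∑ j, sourceNoise (H j *ᵥ a) (s j)) ^ 2 ∂(Measure.pi fun j => sourceLaw d k ση (μξ j))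
      ≤ m * (ση ^ 2 / d * overparamFactor d k
          + σξ ^ 2 * (overparamFactor d k / (|(d : ℝ) - k| - 1))) * (a ⬝ᵥ a) := by
  have := fun j => isProbabilityMeasure_sourceLaw (d := d) (k := k) (ση := ση) (hξ j)
  have h4 := integral_pi_sum_sq (μ := fun j => sourceLaw d k ση (μξ j))
    (X := fun j s => sourceNoise (H j *ᵥ a) s)
    fun j => memLp_sourceNoise hd h₁ h₂ h₃ (hξ j) (H j *ᵥ a)
  refine ⟨h4.1, ?_⟩
  rw [h4.2]
  simp only [integral_sourceNoise hd h₁ h₂ h₃ (hξ _)]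
  simp only [ne_eq, OfNat.ofNat_ne_zero, not_false_eq_true, zero_pow, sub_zero,
    Finset.sum_const_zero, add_zero]
  refine (Finset.sum_le_sum fun j _ =>
    (sourceNoise_sq_moment hd h₁ h₂ h₃ (hξ j) (H j *ᵥ a)).2).trans (le_of_eq ?_)
  simp only [dotProduct_orthogonal (hH _), Finset.sum_const, Finset.card_univ, Fintype.card_fin,
    nsmul_eq_mul]
  ring

/-- Second moments of the error of the averaged source estimates. -/
theorem transferCenter_sq_moment (hd : 0 < d) (hm : 0 < m) (hb : 0 < b) (h₁ : d + 1 ≠ k)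
    (h₂ : d ≠ k) (h₃ : d ≠ k + 1) (hξ : ∀ j, IsNoiseLaw (μξ j) σξ)
    (hH : ∀ j, (H j)ᵀ * H j = 1) (a : Fin d → ℝ) :
    Integrable (fun w => (a ⬝ᵥ (transferCenter H w - w.1)) ^ 2)
        ((isoGaussian d (b / d)).prod (Measure.pi fun j => sourceLaw d k ση (μξ j))) ∧
      ∫ w, (a ⬝ᵥ (transferCenter H w - w.1)) ^ 2
          ∂((isoGaussian d (b / d)).prod (Measure.pi fun j => sourceLaw d k ση (μξ j)))
        ≤ transferVariance d m k b ση σξ * (a ⬝ᵥ a) := by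
  have := fun j => isProbabilityMeasure_sourceLaw (d := d) (k := k) (ση := ση) (hξ j)
  have hbd : 0 ≤ b / d := by positivity
  have hβ := isIsotropicInputLaw_isoGaussian d hbd
  obtain ⟨hU, hU'⟩ := sum_sourceDefect_moment (ση := ση) (k := k) hd hξ hH a
  obtain ⟨hN, hN'⟩ := sum_sourceNoise_moment (ση := ση) hd h₁ h₂ h₃ hξ hH a
  have hm2 : (0 : ℝ) < m ^ 2 := by positivity
  set U : (Fin m → SourceSample d k) → Fin d → ℝ := fun s => -∑ j, sourceDefect (H j) a (s j)
  set N : (Fin m → SourceSample d k) → ℝ := fun s => ∑ j, sourceNoise (H j *ᵥ a) (s j)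
  have hUN : Integrable (fun s => b / d * (U s ⬝ᵥ U s) + N s ^ 2)
      (Measure.pi fun j => sourceLaw d k ση (μξ j)) := (hU.const_mul _).add hN
  have hUm : ∀ i, Measurable fun s => U s i := fun i => by
    simp only [U, Pi.neg_apply, Finset.sum_apply]
    exact (Finset.measurable_sum _ fun j _ =>
      (measurable_sourceDefect (H j) a i).comp (measurable_pi_apply j)).neg
  have hNm : Measurable N := Finset.measurable_sum _ fun j _ =>
    (measurable_sourceNoise (H j *ᵥ a)).comp (measurable_pi_apply j)
  have hF : Measurable fun w : (Fin d → ℝ) × (Fin m → SourceSample d k) =>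
      (U w.2 ⬝ᵥ w.1 + N w.2) ^ 2 :=
    ((measurable_dotProduct (fun i => (hUm i).comp measurable_snd) fun i => by fun_prop).add
      (hNm.comp measurable_snd)).pow_const 2
  have hval : ∫ s, (b / d * (U s ⬝ᵥ U s) + N s ^ 2)
      ∂(Measure.pi fun j => sourceLaw d k ση (μξ j))
      ≤ m ^ 2 * (transferVariance d m k b ση σξ * (a ⬝ᵥ a)) := by
    rw [integral_add (hU.const_mul _) hN, integral_const_mul, hU']
    refine (add_le_add_right hN' _).trans (le_of_eq ?_)
    rw [transferVariance]
    field_simp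
  have h0 : 0 ≤ ∫ s, (b / d * (U s ⬝ᵥ U s) + N s ^ 2)
      ∂(Measure.pi fun j => sourceLaw d k ση (μξ j)) := integral_nonneg fun s => by
    have := dotProduct_self_nonneg_real (U s)
    positivity
  have hin : ∀ s, ∫⁻ β, ENNReal.ofReal ((U s ⬝ᵥ β + N s) ^ 2) ∂isoGaussian d (b / d)
      = ENNReal.ofReal (b / d * (U s ⬝ᵥ U s) + N s ^ 2) := fun s =>
    lintegral_ofReal_eq (hβ.integrable_add_sq (U s) (N s)) (fun _ => sq_nonneg _)
      (hβ.integral_add_sq (U s) (N s))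
  obtain ⟨h5, h6⟩ := integrable_and_integral_le
    (P := (isoGaussian d (b / d)).prod (Measure.pi fun j => sourceLaw d k ση (μξ j)))
    (h0.trans hval) hF (fun _ => sq_nonneg _) (by
      refine (lintegral_prod_symm _ (ENNReal.measurable_ofReal.comp hF).aemeasurable).trans_le ?_
      refine (lintegral_congr hin).trans_le ?_
      refine (lintegral_ofReal_eq hUN (fun s => ?_) rfl).trans_le (ENNReal.ofReal_le_ofReal hval)
      have := dotProduct_self_nonneg_real (U s)
      positivity)
  have e : ∀ w : (Fin d → ℝ) × (Fin m → SourceSample d k),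
      (a ⬝ᵥ (transferCenter H w - w.1)) ^ 2
        = ((m : ℝ)⁻¹) ^ 2 * (U w.2 ⬝ᵥ w.1 + N w.2) ^ 2 := fun w => by
    rw [dotProduct_transferCenter_sub hm hH, mul_pow]
  simp only [e]
  refine ⟨h5.const_mul _, ?_⟩
  rw [integral_const_mul]
  refine (mul_le_mul_of_nonneg_left h6 (by positivity)).trans (le_of_eq ?_)
  field_simp

end Transfer

/-! ### Comparison of the conditional risks -/

section Risk

variable {d n : ℕ}

/-- The expected test error given the training inputs `X`, for penalty `t` and a centre whose
error has variance `q` per coordinate; `c` and `σ²` are the variances of the inputs and of the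
noise. -/
noncomputable def conditionalRisk (c σ t q : ℝ) (X : Matrix (Fin n) (Fin d) ℝ) : ℝ :=
  c * (σ ^ 2 * (ridgeResolvent t X * Xᵀ * (ridgeResolvent t X * Xᵀ)ᵀ).trace
    + t ^ 2 * q * (ridgeResolvent t X * (ridgeResolvent t X)ᵀ).trace) + σ ^ 2

theorem trace_mul_transpose_nonneg {p q : ℕ} (A : Matrix (Fin p) (Fin q) ℝ) :
    0 ≤ (A * Aᵀ).trace := by
  simp only [Matrix.trace, Matrix.diag_apply, Matrix.mul_apply, Matrix.transpose_apply]
  exact Finset.sum_nonneg fun i _ => Finset.sum_nonneg fun j _ => mul_self_nonneg _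

theorem ridgeResolvent_posDef {t : ℝ} (ht : 0 < t) (X : Matrix (Fin n) (Fin d) ℝ) :
    (ridgeResolvent t X).PosDef := (posDef_gram_add ht X).inv

theorem ridgeResolvent_transpose {t : ℝ} (ht : 0 < t) (X : Matrix (Fin n) (Fin d) ℝ) :
    (ridgeResolvent t X)ᵀ = ridgeResolvent t X := by
  have := (ridgeResolvent_posDef ht X).isHermitian.eq
  rwa [Matrix.conjTranspose_eq_transpose_of_trivial] at this

theorem ridgeResolvent_mul_gram {t : ℝ} (ht : 0 < t) (X : Matrix (Fin n) (Fin d) ℝ) :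
    ridgeResolvent t X * (Xᵀ * X) = 1 - t • ridgeResolvent t X := by
  rw [← ridgeResolvent_mul ht X, Matrix.mul_add, Matrix.mul_smul, Matrix.mul_one]
  abel

theorem gram_mul_ridgeResolvent {t : ℝ} (ht : 0 < t) (X : Matrix (Fin n) (Fin d) ℝ) :
    Xᵀ * X * ridgeResolvent t X = 1 - t • ridgeResolvent t X := by
  have := congrArg Matrix.transpose (ridgeResolvent_mul_gram ht X)
  simpa [Matrix.transpose_mul, ridgeResolvent_transpose ht, Matrix.mul_assoc] using this

/-- The resolvent identity. -/
theorem ridgeResolvent_sub {s t : ℝ} (hs : 0 < s) (ht : 0 < t) (X : Matrix (Fin n) (Fin d) ℝ) :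
    ridgeResolvent s X - ridgeResolvent t X
      = (t - s) • (ridgeResolvent t X * ridgeResolvent s X) := by
  have h1 : ridgeResolvent t X * (Xᵀ * X) * ridgeResolvent s X
      = ridgeResolvent s X - t • (ridgeResolvent t X * ridgeResolvent s X) := by
    rw [ridgeResolvent_mul_gram ht, Matrix.sub_mul, Matrix.one_mul, Matrix.smul_mul]
  have h2 : ridgeResolvent t X * (Xᵀ * X) * ridgeResolvent s X
      = ridgeResolvent t X - s • (ridgeResolvent t X * ridgeResolvent s X) := by
    rw [Matrix.mul_assoc, gram_mul_ridgeResolvent hs, Matrix.mul_sub, Matrix.mul_one,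
      Matrix.mul_smul]
  rw [h1] at h2
  rw [sub_smul, ← sub_eq_zero]
  have := sub_eq_zero.2 h2
  rw [← this]
  abel

/-- Sandwiching the Gram matrix between resolvents: `tr (B Xᵀ X B) = tr B - t tr B²`. -/
theorem trace_ridgeResolvent_gram {t : ℝ} (ht : 0 < t) (X : Matrix (Fin n) (Fin d) ℝ) :
    (ridgeResolvent t X * Xᵀ * (ridgeResolvent t X * Xᵀ)ᵀ).trace = (ridgeResolvent t X).trace
      - t * (ridgeResolvent t X * (ridgeResolvent t X)ᵀ).trace := by
  have h : ridgeResolvent t X * Xᵀ * (ridgeResolvent t X * Xᵀ)ᵀ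
      = ridgeResolvent t X - t • (ridgeResolvent t X * ridgeResolvent t X) := by
    rw [Matrix.transpose_mul, Matrix.transpose_transpose, ridgeResolvent_transpose ht,
      Matrix.mul_assoc, ← Matrix.mul_assoc Xᵀ, gram_mul_ridgeResolvent ht, Matrix.mul_sub,
      Matrix.mul_one, Matrix.mul_smul]
  rw [h, ridgeResolvent_transpose ht, Matrix.trace_sub, Matrix.trace_smul, smul_eq_mul]

theorem conditionalRisk_eq_of_optimal {c σ s q : ℝ} (hs : 0 < s) (hopt : σ ^ 2 = s * q)
    (X : Matrix (Fin n) (Fin d) ℝ) :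
    conditionalRisk c σ s q X = c * (q * (s * (ridgeResolvent s X).trace)) + σ ^ 2 := by
  rw [conditionalRisk, trace_ridgeResolvent_gram hs, hopt]
  ring

/-- The penalty `s = σ² / q` is optimal for every realization of the training inputs: the excess
risk of another penalty `t` is a nonnegative multiple of `(t - s)²`. -/
theorem conditionalRisk_optimal_le {c σ s t q : ℝ} (hc : 0 ≤ c) (hq : 0 ≤ q) (hs : 0 < s)
    (ht : 0 < t) (hopt : σ ^ 2 = s * q) (X : Matrix (Fin n) (Fin d) ℝ) :
    conditionalRisk c σ s q X ≤ conditionalRisk c σ t q X := by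
  rw [conditionalRisk_eq_of_optimal hs hopt, conditionalRisk, trace_ridgeResolvent_gram ht]
  set B := ridgeResolvent t X with hB
  set C := ridgeResolvent s X with hC
  have hBt : Bᵀ = B := ridgeResolvent_transpose ht X
  have e1 : C.trace - B.trace = (t - s) * (B * C).trace := by
    rw [← Matrix.trace_sub, ridgeResolvent_sub hs ht, Matrix.trace_smul, smul_eq_mul]
  have e2 : t * (B * B).trace - s * (B * C).trace
      = (t - s) * (B * (Xᵀ * X) * (B * C)).trace := by
    have : t • (B * B) - s • (B * C) = (t - s) • (B * (Xᵀ * X) * (B * C)) := by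
      rw [← Matrix.mul_smul (B * (Xᵀ * X)), ← ridgeResolvent_sub hs ht, Matrix.mul_sub,
        Matrix.mul_assoc B, gram_mul_ridgeResolvent hs, Matrix.mul_assoc B,
        gram_mul_ridgeResolvent ht, ← hB, ← hC]
      simp only [Matrix.mul_sub, Matrix.mul_one, Matrix.mul_smul]
      abel
    simpa only [Matrix.trace_sub, Matrix.trace_smul, smul_eq_mul] using congrArg Matrix.trace this
  have e3 : 0 ≤ (B * (Xᵀ * X) * (B * C)).trace := by
    have h1 : ((X * B) * C * (X * B)ᴴ).PosSemidef :=
      (ridgeResolvent_posDef hs X).posSemidef.mul_mul_conjTranspose_same (X * B)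
    have h2 := h1.trace_nonneg
    rw [Matrix.conjTranspose_eq_transpose_of_trivial, Matrix.transpose_mul, hBt,
      Matrix.trace_mul_comm] at h2
    have h3 : B * Xᵀ * (X * B * C) = B * (Xᵀ * X) * (B * C) := by simp only [Matrix.mul_assoc]
    rwa [h3] at h2
  rw [hBt, hopt]
  have key : 0 ≤ (t - s) ^ 2 * (B * (Xᵀ * X) * (B * C)).trace := by positivity
  have key2 : s * C.trace ≤ s * (B.trace - t * (B * B).trace) + t ^ 2 * (B * B).trace := by
    nlinarith [key, e1, e2]
  have := mul_le_mul_of_nonneg_left key2 (mul_nonneg hc hq)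
  nlinarith [this]

theorem trace_ridgeResolvent_le {t : ℝ} (ht : 0 < t) (X : Matrix (Fin n) (Fin d) ℝ) :
    t * (ridgeResolvent t X).trace ≤ d := by
  have h1 : 0 ≤ (X * ridgeResolvent t X * Xᴴ).trace :=
    ((ridgeResolvent_posDef ht X).posSemidef.mul_mul_conjTranspose_same X).trace_nonneg
  rw [Matrix.conjTranspose_eq_transpose_of_trivial, Matrix.trace_mul_comm, ← Matrix.mul_assoc,
    gram_mul_ridgeResolvent ht, Matrix.trace_sub, Matrix.trace_smul, Matrix.trace_one,
    Fintype.card_fin, smul_eq_mul] at h1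
  linarith

theorem conditionalRisk_strictMono {c σ t q q' : ℝ} (hd : 0 < d) (hc : 0 < c) (ht : 0 < t)
    (hq : q < q') (X : Matrix (Fin n) (Fin d) ℝ) :
    conditionalRisk c σ t q X < conditionalRisk c σ t q' X := by
  have hpos : 0 < (ridgeResolvent t X * (ridgeResolvent t X)ᵀ).trace := by
    refine lt_of_le_of_ne (trace_mul_transpose_nonneg _) fun h0 => ?_
    have h1 : ridgeResolvent t X = 0 := by
      rw [← Matrix.trace_mul_conjTranspose_self_eq_zero_iff,
        Matrix.conjTranspose_eq_transpose_of_trivial, ← h0]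
    have h2 := ridgeResolvent_mul ht X
    rw [h1, Matrix.zero_mul] at h2
    have := congrFun (congrFun h2 ⟨0, hd⟩) ⟨0, hd⟩
    simp at this
  have : t ^ 2 * q < t ^ 2 * q' := mul_lt_mul_of_pos_left hq (by positivity)
  have := mul_lt_mul_of_pos_right this hpos
  unfold conditionalRisk
  gcongr

theorem measurable_conditionalRisk (c σ t q : ℝ) :
    Measurable fun X : Fin n → Fin d → ℝ => conditionalRisk c σ t q (Matrix.of X) := by
  have hR := measurable_ridgeResolvent_entry t (measurable_of_entry (q := n) (p := d))
  have h1 := measurable_mul_entry hR (G := fun X : Fin n → Fin d → ℝ => (Matrix.of X)ᵀ)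
    fun a b => measurable_of_entry b a
  have h2 := fun i => measurable_mul_entry h1 (fun a b => h1 b a) i i
  have h3 := fun i => measurable_mul_entry hR (fun a b => hR b a) i i
  exact (((Finset.measurable_sum _ fun i _ => h2 i).const_mul _).add
    ((Finset.measurable_sum _ fun i _ => h3 i).const_mul _)).const_mul _ |>.add_const _

theorem smul_mulVec_dotProduct_self {p : ℕ} (t : ℝ) (B : Matrix (Fin p) (Fin d) ℝ)
    (v : Fin d → ℝ) :
    (t • (B *ᵥ v)) ⬝ᵥ (t • (B *ᵥ v)) = t ^ 2 * ∑ i, (B.row i ⬝ᵥ v) ^ 2 := by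
  simp only [dotProduct_smul, smul_dotProduct, smul_eq_mul]
  have : (B *ᵥ v) ⬝ᵥ (B *ᵥ v) = ∑ i, (B.row i ⬝ᵥ v) ^ 2 := by
    simp [dotProduct, Matrix.mulVec, sq]
  rw [this]
  ring

theorem sum_row_dotProduct_self {p : ℕ} (B : Matrix (Fin p) (Fin d) ℝ) :
    ∑ i, B.row i ⬝ᵥ B.row i = (B * Bᵀ).trace := by
  simp [Matrix.trace, Matrix.mul_apply, dotProduct]

/-- The risk given the training inputs, from the second moments of the error of the centre. -/
theorem lintegral_centre_error {Ω : Type*} [MeasurableSpace Ω] {P : Measure Ω}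
    [IsProbabilityMeasure P] {V : Ω → Fin d → ℝ} {c σ t : ℝ} (hc : 0 ≤ c)
    (hi : ∀ a, Integrable (fun w => (a ⬝ᵥ V w) ^ 2) P) (X : Matrix (Fin n) (Fin d) ℝ) :
    ∫⁻ w, ENNReal.ofReal (c * (σ ^ 2 * (ridgeResolvent t X * Xᵀ *
        (ridgeResolvent t X * Xᵀ)ᵀ).trace + (t • (ridgeResolvent t X *ᵥ V w)) ⬝ᵥ
          (t • (ridgeResolvent t X *ᵥ V w))) + σ ^ 2) ∂P
      = ENNReal.ofReal (c * (σ ^ 2 * (ridgeResolvent t X * Xᵀ *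
        (ridgeResolvent t X * Xᵀ)ᵀ).trace
          + t ^ 2 * ∑ i, ∫ w, ((ridgeResolvent t X).row i ⬝ᵥ V w) ^ 2 ∂P) + σ ^ 2) := by
  set B := ridgeResolvent t X
  set K := σ ^ 2 * (B * Xᵀ * (B * Xᵀ)ᵀ).trace with hK
  have hK0 : 0 ≤ K := mul_nonneg (sq_nonneg σ) (trace_mul_transpose_nonneg _)
  simp only [smul_mulVec_dotProduct_self]
  have h1 : Integrable (fun w => t ^ 2 * ∑ i, (B.row i ⬝ᵥ V w) ^ 2) P :=
    (integrable_finsetSum _ fun i _ => hi _).const_mul _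
  have h2 : Integrable (fun w => K + t ^ 2 * ∑ i, (B.row i ⬝ᵥ V w) ^ 2) P :=
    (integrable_const _).add h1
  have h3 : Integrable (fun w => c * (K + t ^ 2 * ∑ i, (B.row i ⬝ᵥ V w) ^ 2) + σ ^ 2) P :=
    (h2.const_mul c).add (integrable_const _)
  refine lintegral_ofReal_eq h3 (fun w => ?_) ?_
  · have := Finset.sum_nonneg fun i (_ : i ∈ Finset.univ) => sq_nonneg (B.row i ⬝ᵥ V w)
    positivity
  · rw [integral_add (h2.const_mul c) (integrable_const _), integral_const_mul,
      integral_add (integrable_const _) h1, integral_const_mul (t ^ 2),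
      integral_finsetSum _ fun i _ => hi _]
    simp

end Risk

theorem transferError_le {d m n k : ℕ} (hd : 0 < d) (hm : 0 < m) (hn : 0 < n)
    {b ση σξ σε c : ℝ} (hb : 0 < b) (hc : 0 < c)
    {H : Fin m → Matrix (Fin d) (Fin d) ℝ} (hH : ∀ j, (H j)ᵀ * H j = 1)
    {μξ : Fin m → Measure ℝ} (hμξ : ∀ j, IsNoiseLaw (μξ j) σξ)
    {μx : Measure (Fin d → ℝ)} (hμx : IsIsotropicInputLaw μx c)
    {με : Measure ℝ} (hμε : IsNoiseLaw με σε)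
    (h₁ : d + 1 ≠ k) (h₂ : d ≠ k) (h₃ : d ≠ k + 1) {α : ℝ} (hα : 0 < α) :
    transferError (jointLaw d m n k b ση μξ μx με) H α
      ≤ ∫⁻ X, ENNReal.ofReal (conditionalRisk c σε (n * α * m)
          (transferVariance d m k b ση σξ) (Matrix.of X)) ∂(Measure.pi fun _ : Fin n => μx) := by
  have := fun j => isProbabilityMeasure_sourceLaw (d := d) (k := k) (ση := ση) (hμξ j)
  have ht : 0 < n * α * m := by positivity
  have hV := fun a => transferCenter_sq_moment (b := b) (ση := ση) hd hm hb h₁ h₂ h₃ hμξ hH a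
  unfold transferError jointLaw
  simp only [transferEstimator_eq_centeredRidge hm _ H hH]
  refine (lintegral_testLoss_centeredRidge ht hc.le hμx hμε (transferCenter H)
    (measurable_transferCenter H)).trans_le ?_
  refine lintegral_mono fun X => ?_
  refine (lintegral_centre_error hc.le (fun a => (hV a).1) (Matrix.of X)).trans_le
    (ENNReal.ofReal_le_ofReal ?_)
  have h4 := Finset.sum_le_sum fun i (_ : i ∈ Finset.univ) =>
    (hV ((ridgeResolvent (n * α * m) (Matrix.of X)).row i)).2
  rw [← Finset.mul_sum, sum_row_dotProduct_self] at h4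
  unfold conditionalRisk
  rw [mul_assoc (_ ^ 2) (transferVariance d m k b ση σξ)]
  gcongr

theorem ridgeError_eq {d m n k : ℕ} (hn : 0 < n)
    {b ση σξ σε c : ℝ} (hb : 0 < b) (hc : 0 < c)
    {μξ : Fin m → Measure ℝ} (hμξ : ∀ j, IsNoiseLaw (μξ j) σξ)
    {μx : Measure (Fin d → ℝ)} (hμx : IsIsotropicInputLaw μx c)
    {με : Measure ℝ} (hμε : IsNoiseLaw με σε) {α : ℝ} (hα : 0 < α) :
    ridgeError (jointLaw d m n k b ση μξ μx με) α
      = ∫⁻ X, ENNReal.ofReal (conditionalRisk c σε (n * α) (b / d) (Matrix.of X))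
          ∂(Measure.pi fun _ : Fin n => μx) := by
  have := fun j => isProbabilityMeasure_sourceLaw (d := d) (k := k) (ση := ση) (hμξ j)
  have ht : 0 < n * α := by positivity
  have hβ := isIsotropicInputLaw_isoGaussian d (s := b / d) (by positivity)
  set P := (isoGaussian d (b / d)).prod (Measure.pi fun j => sourceLaw d k ση (μξ j))
  have hfst : MeasurePreserving (Prod.fst : (Fin d → ℝ) × (Fin m → SourceSample d k) → Fin d → ℝ)
      P (isoGaussian d (b / d)) := measurePreserving_fst
  have e : ∀ a β : Fin d → ℝ, (a ⬝ᵥ (0 - β)) ^ 2 = (a ⬝ᵥ β) ^ 2 := fun a β => by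
    rw [zero_sub, dotProduct_neg, neg_sq]
  have hi : ∀ a, Integrable (fun w => (a ⬝ᵥ (0 - w.1)) ^ 2) P := fun a => by
    simp only [e]
    exact hfst.integrable_comp_of_integrable (hβ.memLp_dotProduct a).integrable_sq
  have hv : ∀ a, ∫ w, (a ⬝ᵥ (0 - w.1)) ^ 2 ∂P = b / d * (a ⬝ᵥ a) := fun a => by
    simp only [e]
    rw [← hβ.integral_dotProduct_sq a]
    have := integral_map (μ := P) hfst.measurable.aemeasurable (f := fun x => (a ⬝ᵥ x) ^ 2)
      (by rw [hfst.map_eq]; exact (hβ.memLp_dotProduct a).integrable_sq.aestronglyMeasurable)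
    rw [hfst.map_eq] at this
    exact this.symm
  unfold ridgeError jointLaw
  simp only [ridgeEstimator_eq_centeredRidge]
  refine (lintegral_testLoss_centeredRidge ht hc.le hμx hμε (fun _ => 0)
    (fun _ => measurable_const)).trans ?_
  refine lintegral_congr fun X => ?_
  refine (lintegral_centre_error hc.le hi (Matrix.of X)).trans ?_
  simp only [hv]
  rw [← Finset.mul_sum, sum_row_dotProduct_self, ← mul_assoc]
  rfl

theorem mainTheorem4 (d m n k : ℕ) (hd : 0 < d) (hm : 0 < m) (hn : 0 < n) (hk : 0 < k)
    (b ση σξ σε c : ℝ) (hb : 0 < b) (hε : 0 < σε) (hc : 0 < c)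
    (H : Fin m → Matrix (Fin d) (Fin d) ℝ) (hH : ∀ j, (H j)ᵀ * H j = 1)
    (μξ : Fin m → Measure ℝ) (hμξ : ∀ j, IsNoiseLaw (μξ j) σξ)
    (μx : Measure (Fin d → ℝ)) (hμx : IsIsotropicInputLaw μx c)
    (με : Measure ℝ) (hμε : IsNoiseLaw με σε)
    (hdk₁ : d + 1 ≠ k) (hdk₂ : d ≠ k) (hdk₃ : d ≠ k + 1)
    (hcond : ση ^ 2 + d * σξ ^ 2 / (|(d : ℝ) - k| - 1)
      < b * (m + ((m : ℝ) - 1) * (1 - overparamFactor d k))) :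
    (⨅ (α : ℝ) (_ : 0 < α), transferError (jointLaw d m n k b ση μξ μx με) H α)
      < ⨅ (α : ℝ) (_ : 0 < α), ridgeError (jointLaw d m n k b ση μξ μx με) α := by
  have := hμx.isProbabilityMeasure
  -- the Bayes optimal penalty for ridge regression
  set s : ℝ := σε ^ 2 * d / b with hs_def
  have hs : 0 < s := by positivity
  have hq : 0 < b / d := by positivity
  have hopt : σε ^ 2 = s * (b / d) := by rw [hs_def]; field_simp
  have hvar := transferVariance_lt hd hm hk hdk₁ hdk₂ hdk₃ hcond
  -- the transfer learning parameter for which the total penalty `n α m` is the same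
  set α : ℝ := s / (n * m) with hα_def
  have hα : 0 < α := by positivity
  have hαs : n * α * m = s := by rw [hα_def]; field_simp
  have hTL := transferError_le (ση := ση) hd hm hn hb hc hH hμξ hμx hμε hdk₁ hdk₂ hdk₃ hα
  rw [hαs] at hTL
  have hstrict : ∫⁻ X, ENNReal.ofReal (conditionalRisk c σε s (transferVariance d m k b ση σξ)
        (Matrix.of X)) ∂(Measure.pi fun _ : Fin n => μx)
      < ∫⁻ X, ENNReal.ofReal (conditionalRisk c σε s (b / d) (Matrix.of X))
        ∂(Measure.pi fun _ : Fin n => μx) := by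
    have hpos : ∀ X : Fin n → Fin d → ℝ, 0 < conditionalRisk c σε s (b / d) (Matrix.of X) := by
      intro X
      have h1 := trace_mul_transpose_nonneg (ridgeResolvent s (Matrix.of X) * (Matrix.of X)ᵀ)
      have h2 := trace_mul_transpose_nonneg (ridgeResolvent s (Matrix.of X))
      unfold conditionalRisk
      positivity
    refine lintegral_strict_mono (IsProbabilityMeasure.ne_zero _)
      (ENNReal.measurable_ofReal.comp (measurable_conditionalRisk c σε s (b / d))).aemeasurable
      ?_ (Filter.Eventually.of_forall fun X => ?_)
    · refine ne_top_of_le_ne_top (b := ENNReal.ofReal (c * (b / d * d) + σε ^ 2))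
        ENNReal.ofReal_ne_top ?_
      refine (lintegral_mono (g := fun _ => ENNReal.ofReal (c * (b / d * d) + σε ^ 2))
        fun X => ENNReal.ofReal_le_ofReal ?_).trans (by simp)
      refine (conditionalRisk_strictMono hd hc hs hvar (Matrix.of X)).le.trans ?_
      rw [conditionalRisk_eq_of_optimal hs hopt]
      have := trace_ridgeResolvent_le hs (Matrix.of X)
      gcongr
    · exact (ENNReal.ofReal_lt_ofReal_iff (hpos X)).2
        (conditionalRisk_strictMono hd hc hs hvar (Matrix.of X))
  refine ((iInf₂_le α hα).trans hTL).trans_lt (hstrict.trans_le (le_iInf₂ fun a ha => ?_))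
  rw [ridgeError_eq hn hb hc hμξ hμx hμε ha]
  exact lintegral_mono fun X => ENNReal.ofReal_le_ofReal
    (conditionalRisk_optimal_le hc.le hq.le hs (by positivity) hopt (Matrix.of X))
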